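/- **Problem and notation.** Let $n\ge 1$ and $f:\mathbb R^n\to\mathbb R$; consider $\min f(x)$ subject to $x\ge 0$. $\|\cdot\|$ is the Euclidean norm or its operator norm, $e=(1,\dots,1)^\top$; for $x>0$ put $X=\mathrm{diag}(x_i)$, $\bar X=\mathrm{diag}(\min(x_i,1))$, and let $\bar X_k,X_k$ be these matrices at $x^k$. For $\mu>0$ let $\phi_\mu(x)=f(x)-\mu\sum_i\log x_i$, so $\nabla\phi_\mu=\nabla f-\mu X^{-1}e$, $\nabla^2\phi_\mu=\nabla^2f+\mu X^{-2}$. Let $\mathrm{sgn}(t)=-1$ for $t<0$ and $1$ for $t\ge0$. **Capped CG**$(H,g,\epsilon,\zeta_r,c_\mu,M)$, for symmetric $H$ and $g\neq0$. Throughout, $\bar H=H+2\epsilon I$, $\kappa=(M+2\epsilon)/\epsilon$, $\hat\zeta_r=\zeta_r/(3\kappa)$, $\tau=\sqrt\kappa/(\sqrt\kappa+1)$, $T=4\kappa^4/(1-\sqrt\tau)^2$, always for the current $M$. "Check $v$" means: if $\|Hv\|>M\|v\|$, set $M\leftarrow\|Hv\|/\|v\|$. A vector $v$ "has low curvature" if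 $v^\top\bar Hv<\epsilon\|v\|^2$. Start with $y^0=0$, $r^0=g$, $p^0=-g$. If $p^0$ has low curvature, return $(\mathrm{NC},p^0)$; otherwise check $p^0$. Then for $j=0,1,\dots$ set $\alpha_j=\|r^j\|^2/((p^j)^\top\bar Hp^j)$, $y^{j+1}=y^j+\alpha_jp^j$, $r^{j+1}=r^j+\alpha_j\bar Hp^j$, $p^{j+1}=-r^{j+1}+(\|r^{j+1}\|^2/\|r^j\|^2)p^j$; increase $j$ by one; check $p^j$, then $y^j$, then $r^j$; and: if $y^j$ has low curvature, return $(\mathrm{NC},y^j)$; else if $\|r^j\|\le\hat\zeta_r\|r^0\|$ and $\|r^j\|_\infty\le c_\mu$, return $(\mathrm{SOL},y^j)$; else if $p^j$ has low curvature, return $(\mathrm{NC},p^j)$; else if $\|r^j\|>\sqrt T\tau^{j/2}\|r^0\|$, compute $y^{j+1}$, find any $i\in\{0,\dots,j-1\}$ such that $y^{j+1}-y^i$ has low curvature and return $(\mathrm{NC},y^{j+1}-y^i)$. One product with $H$ is needed for each $p^j$ computed; the products of $H$ with $y^j$ and $r^j$ follow by linear combination. The iterates $y^i$ need not be stored; in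 the last case they are then generated again, and the products that this takes are counted again. **Algorithm.** Inputs: $\epsilon_g\in(0,1)$; $\theta,\zeta_r,\bar\zeta,\eta\in(0,1)$; $\beta\in[\epsilon_g^{1/2},1)$; $x^0>0$; $\hat M\ge0$. Set $\epsilon_H=\epsilon_g^{1/2}$, $\mu=\epsilon_g/4$, $c_\mu=\bar\zeta\mu$. For $k=0,1,\dots$: * If $[\nabla f(x^k)]_i\le-\epsilon_g$ for some $i$ or $\|\bar X_k\nabla f(x^k)\|_\infty>\epsilon_g$: let $H=\bar X_k\nabla^2\phi_\mu(x^k)\bar X_k$, $g=g^k:=\bar X_k\nabla\phi_\mu(x^k)$, and let $\hat d$ be the direction returned by Capped CG$(H,g,\epsilon_H,\zeta_r,c_\mu,\hat M+\mu)$. Put $d^k=-\mathrm{sgn}(g^\top\hat d)\min\{|\hat d^\top H\hat d|/\|\hat d\|^3,\ \beta/\|X_k^{-1}\bar X_k\hat d\|_\infty\}\,\hat d$ if its type is NC and $d^k=\min\{1,\beta/\|X_k^{-1}\bar X_k\hat d\|_\infty\}\,\hat d$ if it is SOL. * Otherwise call a minimum eigenvalue oracle for $\bar X_k\nabla^2f(x^k)\bar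 X_k$. It either certifies (possibly erroneously) that the least eigenvalue is at least $-\epsilon_H$, and the algorithm terminates, or returns a unit vector $v$ with $v^\top\bar X_k\nabla^2f(x^k)\bar X_kv\le-\epsilon_H/2$, and $d^k=-\mathrm{sgn}(v^\top\bar X_k\nabla\phi_\mu(x^k))\min\{|v^\top\bar X_k\nabla^2\phi_\mu(x^k)\bar X_kv|,\ \beta/\|X_k^{-1}\bar X_kv\|_\infty\}\,v$. * Set $x^{k+1}=x^k+\theta^{j_k}\bar X_kd^k$ for the smallest integer $j_k\ge0$ with $\phi_\mu(x^k+\theta^{j_k}\bar X_kd^k)<\phi_\mu(x^k)-\frac\eta6\theta^{3j_k}\|d^k\|^3$. **Assumptions.** (1) On an open set containing all iterates and all segments $[x^k,x^k+\bar X_kd^k]$, $f$ is twice continuously differentiable, $\nabla f$ is Lipschitz and $\nabla^2f$ is Lipschitz with constant $L_H>0$. (2) $f\ge f_{\rm low}$ on the positive orthant. (3) $\|\nabla f(x^k)\|\le U_g$ and $\|\nabla^2f(x^k)\|\le U_H$ at all iterates, where $U_g,U_H>0$. (4) All values of $M$ used or calculated in the calls of Capped CG satisfy $M\le U_H+\mu$.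 **Constants.** With $D=(L_H+\eta)(1-\beta)^2+(2-\beta)$, $$c_d=\min\Big\{\tfrac{1-\bar\zeta}9,\ \big(\tfrac3{2L_H}\big)^{1/2},\ \tfrac1{2(L_H+9/2+\zeta_r)}\Big\},\quad c_{\rm sol}=\min\Big\{c_d,\tfrac{6(1-\beta)^2\theta^2}{D}\Big\},\quad c_{\rm nc}=\min\Big\{1,\tfrac{3(1-\beta)^2\theta}{D}\Big\},$$ $c_{\rm all}=\min\{c_{\rm sol},c_{\rm nc}\}$, $\omega_1=\max\{3\sqrt n/(\eta c_{\rm all}^2),\|x^0\|_\infty\}$, $$\bar K_1=\Big\lceil\frac{12\big(\mu n(\log\omega_1-\min_i\log x^0_i)+f(x^0)-f_{\rm low}\big)}{\eta c_{\rm all}^3}\,\epsilon_g^{-3/2}\Big\rceil .$$ For a real number $R$, let $J=J(R)$ be the smallest nonnegative integer with $\sqrt T\,\tau^{J/2}R\le\min\{\hat\zeta_rR,c_\mu\}$, where $T,\tau,\hat\zeta_r$ are formed with $M=U_H+\mu$ and $\epsilon=\epsilon_H$. **Statement (Corollary 4.8).** Under these assumptions the algorithm generates, for some $k\le\bar K_1+1$,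 an iterate $x^k>0$ with $$\nabla f(x^k)\ge-\epsilon_ge,\qquad\|\bar X_k\nabla f(x^k)\|_\infty\le\epsilon_g,$$ and for every $R\le U_g+\mu\sqrt n$ that bounds $\|g^l\|$ for all $l<k$ (for instance $R=U_g+\mu\sqrt n$, or the largest of these initial residual norms), the total number of gradient evaluations and Hessian-vector products used up to this point, including the evaluation of $\nabla f(x^k)$, is at most $$B=\big(2\min\{n,J\}+2\big)(\bar K_1+1).$$ Moreover, $B=\tilde{\mathcal O}(\epsilon_g^{-7/4}+n\epsilon_g^{-3/4})$ if $J<n$, and $B=\tilde{\mathcal O}(n\epsilon_g^{-3/2})$ if $J\ge n$. That is: given $\theta,\zeta_r,\bar\zeta,\beta,\eta,L_H,U_g,U_H$ and numbers $\Delta$ and $0<a\le b$, there are $C$ and $q$ such that, for all $n$, $f$, $f_{\rm low}$, $x^0$, $\epsilon_g$, $\hat M$ as above with $f(x^0)-f_{\rm low}\le\Delta$ and $a\le x^0_i\le b$ for all $i$, $B$ is at most $C(1+\log(n/\epsilon_g))^q$ times $\epsilon_g^{-7/4}+n\epsilon_g^{-3/4}$, respectively $n\epsilon_g^{-3/2}$.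 -/

import Mathlib

open scoped Gradient InnerProductSpace

noncomputable section

/-- Euclidean space `ℝⁿ`. -/
abbrev E (n : ℕ) : Type := EuclideanSpace ℝ (Fin n)

namespace LogBarrier

/-! ### Vectors, diagonal scalings, derivatives -/

/-- The max-norm `‖v‖_∞`. -/
def supNorm {n : ℕ} (v : E n) : ℝ := ‖(WithLp.ofLp v : Fin n → ℝ)‖

/-- The diagonal matrix `diag(w)`, acting on `ℝⁿ`. -/
def diagOp {n : ℕ} (w : Fin n → ℝ) : E n →L[ℝ] E n :=
  Matrix.toEuclideanCLM (n := Fin n) (𝕜 := ℝ) (Matrix.diagonal w)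

theorem diagOp_apply {n : ℕ} (w : Fin n → ℝ) (v : E n) (i : Fin n) :
    diagOp w v i = w i * v i := by
  have h : WithLp.ofLp (diagOp w v) = (Matrix.diagonal w).mulVec (WithLp.ofLp v) := by
    simp [diagOp]
  have h2 := congrFun h i
  rw [Matrix.mulVec_diagonal] at h2
  exact h2

/-- `X̄ = diag(min(x, e))`. -/
def barX {n : ℕ} (x : E n) : E n →L[ℝ] E n := diagOp (fun i => min (x i) 1)

/-- `X⁻¹ = diag(1/xᵢ)`. -/
def invX {n : ℕ} (x : E n) : E n →L[ℝ] E n := diagOp (fun i => (x i)⁻¹)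

/-- The Hessian `∇²f(x)`, the derivative of the gradient. -/
def hess {n : ℕ} (f : E n → ℝ) (x : E n) : E n →L[ℝ] E n := fderiv ℝ (∇ f) x

/-- The log-barrier function `φ_μ(x) = f(x) - μ ∑ log xᵢ`. -/
def phi {n : ℕ} (f : E n → ℝ) (μ : ℝ) (x : E n) : ℝ := f x - μ * ∑ i, Real.log (x i)

/-- `∇φ_μ(x) = ∇f(x) - μ X⁻¹ e`. -/
def gradPhi {n : ℕ} (f : E n → ℝ) (μ : ℝ) (x : E n) : E n :=
  ∇ f x - μ • WithLp.toLp 2 (fun i => (x i)⁻¹)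

/-- `∇²φ_μ(x) = ∇²f(x) + μ X⁻²`. -/
def hessPhi {n : ℕ} (f : E n → ℝ) (μ : ℝ) (x : E n) : E n →L[ℝ] E n :=
  hess f x + μ • (invX x ∘L invX x)

/-- The scaled gradient `X̄ ∇φ_μ(x)`. -/
def scaledGrad {n : ℕ} (f : E n → ℝ) (μ : ℝ) (x : E n) : E n := barX x (gradPhi f μ x)

/-- The scaled Hessian `X̄ ∇²φ_μ(x) X̄`. -/
def scaledHess {n : ℕ} (f : E n → ℝ) (μ : ℝ) (x : E n) : E n →L[ℝ] E n :=
  barX x ∘L hessPhi f μ x ∘L barX x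

/-- The sign, with the convention `sgn 0 = 1` (a sign must be chosen there, as `0` would
give the zero direction). -/
def sgn (t : ℝ) : ℝ := if t < 0 then -1 else 1

/-- The approximate first-order conditions with tolerance `εg` (and strict feasibility). -/
def FirstOrder {n : ℕ} (f : E n → ℝ) (εg : ℝ) (x : E n) : Prop :=
  (∀ i, 0 < x i) ∧ (∀ i, -εg ≤ (∇ f x) i) ∧ supNorm (barX x (∇ f x)) ≤ εg

/-! ### Capped conjugate gradients -/

namespace CG

/-- `κ = (M + 2ε)/ε`. -/
def kappa (M ε : ℝ) : ℝ := (M + 2 * ε) / ε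

/-- `ζ̂_r = ζ_r / (3κ)`. -/
def zetaHat (M ε ζr : ℝ) : ℝ := ζr / (3 * kappa M ε)

/-- `τ = √κ / (√κ + 1)`. -/
def tau (M ε : ℝ) : ℝ := √(kappa M ε) / (√(kappa M ε) + 1)

/-- `T = 4κ⁴ / (1 - √τ)²`. -/
def capT (M ε : ℝ) : ℝ := 4 * kappa M ε ^ 4 / (1 - √(tau M ε)) ^ 2

/-- For initial residual norm `R = ‖r⁰‖`, the smallest integer `J` such that
`√T τ^{J/2} R ≤ min {ζ̂_r R, c_μ}`. -/
def capJ (M ε ζr cμ R : ℝ) : ℕ :=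
  sInf {J : ℕ | √(capT M ε) * tau M ε ^ ((J : ℝ) / 2) * R ≤ min (zetaHat M ε ζr * R) cμ}

/-- The state of the method after some number of iterations. The products of `H` with the
three vectors are carried along: only `Hp` is obtained by applying `H`, the other two by the
linear recurrences, so that an iteration takes one matrix-vector product. -/
structure State (n : ℕ) where
  y : E n
  r : E n
  p : E n
  Hy : E n
  Hr : E n
  Hp : E n
  M : ℝ

/-- `M`, replaced by `‖Hv‖/‖v‖` when `‖Hv‖ > M‖v‖`. -/
def bump {n : ℕ} (M : ℝ) (Hv v : E n) : ℝ := if M * ‖v‖ < ‖Hv‖ then ‖Hv‖ / ‖v‖ else M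

/-- The initial state `y⁰ = 0`, `r⁰ = g`, `p⁰ = -g` (one product, `H p⁰`). -/
def init {n : ℕ} (H : E n →L[ℝ] E n) (g : E n) (M : ℝ) : State n :=
  let q := H (-g)
  { y := 0, r := g, p := -g, Hy := 0, Hr := -q, Hp := q, M := bump M q (-g) }

/-- `α_j = ‖r^j‖² / (p^j)ᵀ H̄ p^j`, where `H̄ = H + 2εI`. -/
def alpha {n : ℕ} (ε : ℝ) (s : State n) : ℝ :=
  ‖s.r‖ ^ 2 / ⟪s.p, s.Hp + (2 * ε) • s.p⟫_ℝ

/-- `y^{j+1} = y^j + α_j p^j`. -/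
def nextY {n : ℕ} (ε : ℝ) (s : State n) : E n := s.y + alpha ε s • s.p

/-- One iteration: the standard conjugate gradient update (one product, `H p^{j+1}`),
then the three checks of the bound `M`, with `p`, `y` and `r` in this order. -/
def next {n : ℕ} (H : E n →L[ℝ] E n) (ε : ℝ) (s : State n) : State n :=
  let a := alpha ε s
  let y' := nextY ε s
  let r' := s.r + a • (s.Hp + (2 * ε) • s.p)
  let b := ‖r'‖ ^ 2 / ‖s.r‖ ^ 2
  let p' := -r' + b • s.p
  let Hy' := s.Hy + a • s.Hp
  let Hp' := H p'
  let Hr' := -Hp' + b • s.Hp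
  { y := y', r := r', p := p', Hy := Hy', Hr := Hr', Hp := Hp',
    M := bump (bump (bump s.M Hp' p') Hy' y') Hr' r' }

/-- The state after `j` iterations. -/
def state {n : ℕ} (H : E n →L[ℝ] E n) (g : E n) (ε M : ℝ) : ℕ → State n
  | 0 => init H g M
  | j + 1 => next H ε (state H g ε M j)

/-- `vᵀ H̄ v < ε ‖v‖²`, given the product `Hv`. -/
def LowCurv {n : ℕ} (ε : ℝ) (Hv v : E n) : Prop := ⟪v, Hv + (2 * ε) • v⟫_ℝ < ε * ‖v‖ ^ 2

/-- `‖r^j‖ ≤ ζ̂_r ‖r⁰‖` and `‖r^j‖_∞ ≤ c_μ`. -/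
def Solved {n : ℕ} (g : E n) (ε ζr cμ : ℝ) (s : State n) : Prop :=
  ‖s.r‖ ≤ zetaHat s.M ε ζr * ‖g‖ ∧ supNorm s.r ≤ cμ

/-- `‖r^j‖ > √T τ^{j/2} ‖r⁰‖`. -/
def Slow {n : ℕ} (g : E n) (ε : ℝ) (j : ℕ) (s : State n) : Prop :=
  √(capT s.M ε) * tau s.M ε ^ ((j : ℝ) / 2) * ‖g‖ < ‖s.r‖

/-- The indices `i ∈ {0, …, j-1}` for which `y^{j+1} - y^i` is a direction of low curvature. -/
def weakIndices {n : ℕ} (H : E n →L[ℝ] E n) (g : E n) (ε M : ℝ) (j : ℕ) : Set ℕ :=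
  let s := state H g ε M
  {i | i < j ∧ LowCurv ε ((s j).Hy + alpha ε (s j) • (s j).Hp - (s i).Hy)
    (nextY ε (s j) - (s i).y)}

/-- The stopping tests passed by the method after `j` iterations: the curvature test for
`p⁰` if `j = 0`, one of the four tests at the end of the loop if `j ≥ 1`. -/
def Stops {n : ℕ} (H : E n →L[ℝ] E n) (g : E n) (ε ζr cμ M : ℝ) (j : ℕ) : Prop :=
  let s := state H g ε M j
  if j = 0 then LowCurv ε s.Hp s.p
  else LowCurv ε s.Hy s.y ∨ Solved g ε ζr cμ s ∨ LowCurv ε s.Hp s.p ∨ Slow g ε j s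

/-- The two kinds of direction: approximate solution, or negative curvature. -/
inductive DType
  | sol
  | nc

/-- Output of the method: type, direction, and number of products with `H` computed. -/
structure Output (n : ℕ) where
  dtype : DType
  d : E n
  products : ℕ

open Classical in
/-- The output when the method stops after `j` iterations. The products `H p⁰, …, H p^j`
have then been computed. In the last case, `pick` selects one of the possible indices `i`,
and the iterates `y⁰, …, y^{j-1}`, which need not have been stored, are generated a second
time, at the price of the products `H p⁰, …, H p^{j-2}`; there is no output if no index `i`
is possible. -/
def output {n : ℕ} (pick : Set ℕ → ℕ) (H : E n →L[ℝ] E n) (g : E n) (ε ζr cμ M : ℝ) (j : ℕ) :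
    Option (Output n) :=
  let s := state H g ε M j
  if j = 0 then some ⟨.nc, s.p, 1⟩
  else if LowCurv ε s.Hy s.y then some ⟨.nc, s.y, j + 1⟩
  else if Solved g ε ζr cμ s then some ⟨.sol, s.y, j + 1⟩
  else if LowCurv ε s.Hp s.p then some ⟨.nc, s.p, j + 1⟩
  else if (weakIndices H g ε M j).Nonempty then
    some ⟨.nc, nextY ε s - (state H g ε M (pick (weakIndices H g ε M j))).y, (j + 1) + (j - 1)⟩
  else none

open Classical in
/-- Capped conjugate gradients: iterate until the first stop. There is no output if the
method never stops. -/
def run {n : ℕ} (pick : Set ℕ → ℕ) (H : E n →L[ℝ] E n) (g : E n) (ε ζr cμ M : ℝ) :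
    Option (Output n) :=
  if h : ∃ j, Stops H g ε ζr cμ M j then output pick H g ε ζr cμ M (Nat.find h) else none

/-- All values of `M` used or calculated in the call are at most `B`. (If the method stops
at once because of the curvature of `p⁰`, then `M` is not updated.) -/
def MBounded {n : ℕ} (H : E n →L[ℝ] E n) (g : E n) (ε ζr cμ M B : ℝ) : Prop :=
  M ≤ B ∧ ∀ j, ¬ Stops H g ε ζr cμ M 0 → (∀ i < j, ¬ Stops H g ε ζr cμ M i) →
    (state H g ε M j).M ≤ B

end CG

/-! ### The log-barrier Newton-CG algorithm -/

/-- The parameters of the algorithm that do not depend on the tolerance. -/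
structure Params where
  θ : ℝ
  ζr : ℝ
  ζbar : ℝ
  β : ℝ
  η : ℝ
  θ_mem : θ ∈ Set.Ioo (0 : ℝ) 1
  ζr_mem : ζr ∈ Set.Ioo (0 : ℝ) 1
  ζbar_mem : ζbar ∈ Set.Ioo (0 : ℝ) 1
  β_mem : β ∈ Set.Ioo (0 : ℝ) 1
  η_mem : η ∈ Set.Ioo (0 : ℝ) 1

/-- A minimum eigenvalue oracle with tolerance `ε`. Its `k`-th answer for the matrix `H` is
either `some v`, where `v` is a unit vector of curvature at most `-ε/2`, or `none`, the
certificate that the least eigenvalue of `H` is at least `-ε`. The certificate may be false: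
the oracle may be randomized, and this is one realization of it. `products` counts the
products with `H` that the answer takes. -/
structure EigOracle (n : ℕ) (ε : ℝ) where
  answer : ℕ → (E n →L[ℝ] E n) → Option (E n)
  products : ℕ → (E n →L[ℝ] E n) → ℕ
  answer_spec : ∀ k H v, answer k H = some v → ‖v‖ = 1 ∧ ⟪v, H v⟫_ℝ ≤ -ε / 2

/-- The input of the algorithm, together with whatever the algorithm leaves open: the
answers of the eigenvalue oracle and the choice `pick k` of an index in a nonempty set, at
iteration `k`. -/
structure Input (P : Params) (n : ℕ) where
  f : E n → ℝ
  x0 : E n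
  εg : ℝ
  Mhat : ℝ
  x0_pos : ∀ i, 0 < x0 i
  εg_mem : εg ∈ Set.Ioo (0 : ℝ) 1
  sqrt_le_β : √εg ≤ P.β
  Mhat_nonneg : 0 ≤ Mhat
  pick : ℕ → Set ℕ → ℕ
  pick_mem : ∀ k S, S.Nonempty → pick k S ∈ S
  oracle : EigOracle n (√εg)

namespace Input

variable {P : Params} {n : ℕ} (A : Input P n)

/-- `ε_H = ε_g^{1/2}`. -/
def εH : ℝ := √A.εg

/-- `μ = ε_g / 4`. -/
def μ : ℝ := A.εg / 4

/-- `c_μ = ζ̄ μ`. -/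
def cμ : ℝ := P.ζbar * A.μ

/-- `M_μ = M̂ + μ`. -/
def Mμ : ℝ := A.Mhat + A.μ

/-- The vector `g = X̄ ∇φ_μ(x)` passed to capped conjugate gradients. -/
def g (x : E n) : E n := scaledGrad A.f A.μ x

/-- The matrix `H = X̄ ∇²φ_μ(x) X̄` passed to capped conjugate gradients. -/
def H (x : E n) : E n →L[ℝ] E n := scaledHess A.f A.μ x

/-- The matrix `X̄ ∇²f(x) X̄` passed to the eigenvalue oracle. -/
def Hf (x : E n) : E n →L[ℝ] E n := barX x ∘L hess A.f x ∘L barX x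

/-- The test that decides whether capped conjugate gradients is called at `x`. -/
def CallsCG (x : E n) : Prop :=
  (∃ i, (∇ A.f x) i ≤ -A.εg) ∨ A.εg < supNorm (barX x (∇ A.f x))

/-- The call of capped conjugate gradients at `x`, in iteration `k`. -/
def cg (k : ℕ) (x : E n) : Option (CG.Output n) :=
  CG.run (A.pick k) (A.H x) (A.g x) A.εH P.ζr A.cμ A.Mμ

/-- The search direction `d^k` from the output of capped conjugate gradients. -/
def scaleCG (x : E n) (o : CG.Output n) : E n :=
  match o.dtype with
  | .nc => (-sgn ⟪A.g x, o.d⟫_ℝ * min (|⟪o.d, A.H x o.d⟫_ℝ| / ‖o.d‖ ^ 3)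
      (P.β / supNorm (invX x (barX x o.d)))) • o.d
  | .sol => min 1 (P.β / supNorm (invX x (barX x o.d))) • o.d

/-- The search direction `d^k` from a direction returned by the eigenvalue oracle. -/
def scaleEig (x v : E n) : E n :=
  (-sgn ⟪v, A.g x⟫_ℝ * min |⟪v, A.H x v⟫_ℝ| (P.β / supNorm (invX x (barX x v)))) • v

open Classical in
/-- The search direction `d^k` of iteration `k` at `x = x^k`; `none` if the algorithm
terminates (or if capped conjugate gradients has no output). -/
def direction (k : ℕ) (x : E n) : Option (E n) :=
  if A.CallsCG x then (A.cg k x).map (A.scaleCG x)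
  else (A.oracle.answer k (A.Hf x)).map (A.scaleEig x)

/-- The sufficient decrease condition for the step length `θ^j`. -/
def Decrease (x d : E n) (j : ℕ) : Prop :=
  phi A.f A.μ (x + P.θ ^ j • barX x d) <
    phi A.f A.μ x - P.η / 6 * (P.θ ^ j) ^ 3 * ‖d‖ ^ 3

open Classical in
/-- The backtracking line search; `none` if it does not terminate. -/
def lineSearch (x d : E n) : Option (E n) :=
  if h : ∃ j, A.Decrease x d j then some (x + P.θ ^ (Nat.find h) • barX x d) else none

/-- The iterates `x^k`; `none` if the algorithm does not get as far as `x^k`. -/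
def iterate : ℕ → Option (E n)
  | 0 => some A.x0
  | k + 1 => (iterate k).bind fun x => (A.direction k x).bind fun d => A.lineSearch x d

open Classical in
/-- The number of gradient evaluations and Hessian-vector products in iteration `k`: the
gradient at `x^k`, and one product with `∇²f(x^k)` for each product with the matrix passed
to capped conjugate gradients or to the eigenvalue oracle. (An iteration in which capped
conjugate gradients has no output has no successor; its cost is irrelevant.) -/
def iterCost (k : ℕ) : ℕ :=
  match A.iterate k with
  | none => 0
  | some x => 1 + if A.CallsCG x then (A.cg k x).elim 0 CG.Output.products
      else A.oracle.products k (A.Hf x)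

/-- The number of gradient evaluations and Hessian-vector products used to compute `x^k` and
the gradient at `x^k`, which is needed to recognize a first-order point. -/
def work (k : ℕ) : ℕ := (∑ l ∈ Finset.range k, A.iterCost l) + 1

/-! ### Assumptions and constants -/

/-- `f` is twice uniformly Lipschitz continuously differentiable on an open neighborhood of
the path of the iterates and trial points, with Lipschitz constant `L_H` for `∇²f`. The trial
points of iteration `k` lie on the segment from `x^k` to `x^k + X̄_k d^k`. -/
def SmoothOnPath (LH : ℝ) : Prop :=
  ∃ Ω : Set (E n), IsOpen Ω ∧
    (∀ k x, A.iterate k = some x → x ∈ Ω) ∧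
    (∀ k x d, A.iterate k = some x → A.direction k x = some d →
      segment ℝ x (x + barX x d) ⊆ Ω) ∧
    ContDiffOn ℝ 2 A.f Ω ∧
    (∃ Lg : ℝ, ∀ x ∈ Ω, ∀ y ∈ Ω, ‖∇ A.f x - ∇ A.f y‖ ≤ Lg * ‖x - y‖) ∧
    (∀ x ∈ Ω, ∀ y ∈ Ω, ‖hess A.f x - hess A.f y‖ ≤ LH * ‖x - y‖)

/-- `f` is bounded below by `f_low` on the interior of the feasible set. -/
def BoundedBelow (flow : ℝ) : Prop := ∀ x : E n, (∀ i, 0 < x i) → flow ≤ A.f x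

/-- `‖∇f(x^k)‖ ≤ U_g` and `‖∇²f(x^k)‖ ≤ U_H` at all iterates. -/
def BoundedDerivs (Ug UH : ℝ) : Prop :=
  ∀ k x, A.iterate k = some x → ‖∇ A.f x‖ ≤ Ug ∧ ‖hess A.f x‖ ≤ UH

/-- The values of `M` used or calculated at each call of capped conjugate gradients are at
most `B`. -/
def MBounded (B : ℝ) : Prop :=
  ∀ k x, A.iterate k = some x → A.CallsCG x →
    CG.MBounded (A.H x) (A.g x) A.εH P.ζr A.cμ A.Mμ B

end Input

/-- `c_d`. -/
def cD (P : Params) (LH : ℝ) : ℝ :=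
  min ((1 - P.ζbar) / 9) (min √(3 / (2 * LH)) (1 / (2 * (LH + 9 / 2 + P.ζr))))

/-- `c_sol`. -/
def cSol (P : Params) (LH : ℝ) : ℝ :=
  min (cD P LH)
    (6 * (1 - P.β) ^ 2 * P.θ ^ 2 / ((LH + P.η) * (1 - P.β) ^ 2 + (2 - P.β)))

/-- `c_nc`. -/
def cNc (P : Params) (LH : ℝ) : ℝ :=
  min 1 (3 * (1 - P.β) ^ 2 * P.θ / ((LH + P.η) * (1 - P.β) ^ 2 + (2 - P.β)))

/-- `c_all`. -/
def cAll (P : Params) (LH : ℝ) : ℝ := min (cSol P LH) (cNc P LH)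

/-- `ω₁ = max {3√n / (η c_all²), ‖x⁰‖_∞}`. -/
def Input.omega1 {P : Params} {n : ℕ} (A : Input P n) (LH : ℝ) : ℝ :=
  max (3 * √n / (P.η * cAll P LH ^ 2)) (supNorm A.x0)

/-- `K̄₁`, the smallest integer not below
`12 (μ n (log ω₁ - minᵢ log xᵢ⁰) + f(x⁰) - f_low) / (η c_all³) · ε_g^{-3/2}`
(a nonnegative number when `f_low ≤ f(x⁰)`, as `ω₁ ≥ ‖x⁰‖_∞`). -/
def Input.K1 {P : Params} {n : ℕ} (A : Input P n) (LH flow : ℝ) : ℕ :=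
  ⌈12 * (A.μ * n * (Real.log (A.omega1 LH) - ⨅ i, Real.log (A.x0 i)) + A.f A.x0 - flow)
      / (P.η * cAll P LH ^ 3) * A.εg ^ (-(3 / 2) : ℝ)⌉₊

end LogBarrier

end

noncomputable section

namespace LogBarrier

/-! ### Elementary facts on vectors -/

/-! Until a first-order point is reached, every iteration calls capped conjugate gradients and the
eigenvalue oracle plays no role. The bound is therefore the number of these iterations times the
cost of one call.

Iterations. Let s = t‖d‖, where t is the accepted step length. Each step lowers φ_μ by at least η
s³/6, and either s ≥ c_all ε_H or the next iterate is first-order (`step_spec`). The long steps come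
from the cubic expansion `phi_taylor`. A shorter step can only be a full, unscaled Newton step, and
then the small residual of the Newton system makes the new gradient small
(`firstOrder_of_short_step`). The barrier term is not bounded below, since iterates may run off to
infinity. But the coordinate sum grows by at most √n ∑ s ≤ √n ∑ s³/(c_all ε_H)², and by the tangent
to the logarithm at ω₁ this costs at most half of the guaranteed decrease (`exists_progress`,
`exists_firstOrder`).

One call. The method stops within n iterations because nonzero residuals are orthogonal, and within
J because a residual that is not slow by then passes the solution test (`run_spec`). The main point
is that a slow residual does expose an index i (`weakIndices_nonempty`). If all differences y^{j+1}
- y^i have curvature at least ε, an estimate-sequence argument as for accelerated gradient methods,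
with y^{j+1} in place of a minimizer, makes ‖r^j‖² decay like τ^j (`residual_bound`). Convexity is
used only along these differences, and the upper bound on H̄ only along the residuals, where the
checks of M provide it.

Orders. Since κ = O(ε_g^{-1/2}), J is of order √κ times a logarithm, that is Õ(ε_g^{-1/4})
(`exists_capJ_bound`); this is multiplied by `exists_K1_bound`. -/

theorem abs_apply_le_supNorm {n : ℕ} (v : E n) (i : Fin n) : |v i| ≤ supNorm v :=
  norm_le_pi_norm (WithLp.ofLp v) i

theorem supNorm_le {n : ℕ} {v : E n} {c : ℝ} (hc : 0 ≤ c) (h : ∀ i, |v i| ≤ c) :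
    supNorm v ≤ c :=
  (pi_norm_le_iff_of_nonneg hc).2 h

theorem abs_apply_le_norm {n : ℕ} (v : E n) (i : Fin n) : |v i| ≤ ‖v‖ :=
  PiLp.norm_apply_le v i

theorem supNorm_le_norm {n : ℕ} (v : E n) : supNorm v ≤ ‖v‖ :=
  supNorm_le (norm_nonneg _) (abs_apply_le_norm v)

theorem supNorm_smul {n : ℕ} (c : ℝ) (v : E n) : supNorm (c • v) = |c| * supNorm v := by
  unfold supNorm
  rw [WithLp.ofLp_smul, norm_smul, Real.norm_eq_abs]

theorem inner_eq_sum {n : ℕ} (u v : E n) : ⟪u, v⟫_ℝ = ∑ i, u i * v i := by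
  simp [PiLp.inner_apply, mul_comm]

theorem inner_diagOp_left {n : ℕ} (w : Fin n → ℝ) (u v : E n) :
    ⟪diagOp w u, v⟫_ℝ = ⟪u, diagOp w v⟫_ℝ := by
  simp only [inner_eq_sum, diagOp_apply]
  exact Finset.sum_congr rfl fun i _ => by ring

namespace CG

/-! ### Conjugate gradients: the standard relations -/

/-- The shifted operator `H̄ = H + 2εI`. -/
def shift {n : ℕ} (H : E n →L[ℝ] E n) (ε : ℝ) (v : E n) : E n := H v + (2 * ε) • v

section Relations

variable {n : ℕ} {H : E n →L[ℝ] E n} {g : E n} {ε M : ℝ}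

theorem state_products (j : ℕ) :
    (state H g ε M j).Hy = H (state H g ε M j).y ∧
    (state H g ε M j).Hr = H (state H g ε M j).r ∧
    (state H g ε M j).Hp = H (state H g ε M j).p := by
  induction j with
  | zero => simp [state, init]
  | succ j ih =>
    obtain ⟨h1, h2, h3⟩ := ih
    refine ⟨?_, ?_, rfl⟩
    · simp [state, next, nextY, h1, h3]
    · simp [state, next, h3]

theorem shift_add (u v : E n) : shift H ε (u + v) = shift H ε u + shift H ε v := by
  simp only [shift, map_add, smul_add]; abel

theorem shift_smul (c : ℝ) (v : E n) : shift H ε (c • v) = c • shift H ε v := by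
  simp only [shift, map_smul, smul_add, smul_comm c]

theorem shift_neg (v : E n) : shift H ε (-v) = -shift H ε v := by
  simp only [shift, map_neg, smul_neg]; abel

theorem inner_shift_comm (hH : ∀ u v, ⟪H u, v⟫_ℝ = ⟪u, H v⟫_ℝ) (u v : E n) :
    ⟪u, shift H ε v⟫_ℝ = ⟪v, shift H ε u⟫_ℝ := by
  simp only [shift, inner_add_right, inner_smul_right, ← hH u v,
    real_inner_comm v (H u), real_inner_comm u v]

theorem state_y_succ (j : ℕ) : (state H g ε M (j + 1)).y =
    (state H g ε M j).y + alpha ε (state H g ε M j) • (state H g ε M j).p := rfl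

theorem state_r_succ (j : ℕ) : (state H g ε M (j + 1)).r =
    (state H g ε M j).r + alpha ε (state H g ε M j) • shift H ε (state H g ε M j).p := by
  simp [state, next, shift, (state_products j).2.2]

theorem state_p_succ (j : ℕ) : (state H g ε M (j + 1)).p =
    -(state H g ε M (j + 1)).r +
      (‖(state H g ε M (j + 1)).r‖ ^ 2 / ‖(state H g ε M j).r‖ ^ 2) • (state H g ε M j).p := rfl

theorem alpha_eq (j : ℕ) : alpha ε (state H g ε M j) = ‖(state H g ε M j).r‖ ^ 2 /
    ⟪(state H g ε M j).p, shift H ε (state H g ε M j).p⟫_ℝ := by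
  simp [alpha, shift, (state_products j).2.2]

theorem state_r_eq (j : ℕ) :
    (state H g ε M j).r = g + shift H ε (state H g ε M j).y := by
  induction j with
  | zero => simp [state, init, shift]
  | succ j ih =>
    rw [state_r_succ, state_y_succ, shift_add, shift_smul, ih]; abel

theorem le_bump (M : ℝ) (v : E n) : M ≤ bump M (H v) v := by
  unfold bump
  split_ifs with h
  · have h0 : 0 < ‖v‖ := by
      rw [norm_pos_iff]
      rintro rfl
      simp at h
    exact (le_div_iff₀ h0).2 h.le
  · exact le_rfl

theorem norm_le_bump (M : ℝ) (v : E n) : ‖H v‖ ≤ bump M (H v) v * ‖v‖ := by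
  unfold bump
  split_ifs with h
  · have h0 : 0 < ‖v‖ := by
      rw [norm_pos_iff]
      rintro rfl
      simp at h
    rw [div_mul_cancel₀ _ h0.ne']
  · exact not_lt.1 h

theorem state_M_succ (j : ℕ) : (state H g ε M (j + 1)).M =
    bump (bump (bump (state H g ε M j).M (H (state H g ε M (j + 1)).p) (state H g ε M (j + 1)).p)
      (H (state H g ε M (j + 1)).y) (state H g ε M (j + 1)).y)
      (H (state H g ε M (j + 1)).r) (state H g ε M (j + 1)).r := by
  rw [← (state_products (j + 1)).1, ← (state_products (j + 1)).2.1, ← (state_products (j + 1)).2.2]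
  rfl

theorem state_M_mono : Monotone fun j => (state H g ε M j).M := by
  refine monotone_nat_of_le_succ fun j => ?_
  rw [state_M_succ]
  exact (le_bump _ _).trans ((le_bump _ _).trans (le_bump _ _))

theorem le_state_M (j : ℕ) : M ≤ (state H g ε M j).M :=
  (le_bump M (-g)).trans (state_M_mono (Nat.zero_le j))

theorem norm_apply_r_le {i j : ℕ} (hij : i ≤ j) :
    ‖H (state H g ε M i).r‖ ≤ (state H g ε M j).M * ‖(state H g ε M i).r‖ := by
  refine le_trans ?_ (mul_le_mul_of_nonneg_right (state_M_mono hij) (norm_nonneg _))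
  cases i with
  | zero =>
    -- r⁰ = g is not checked itself; the check of p⁰ = -g does it.
    have := norm_le_bump (H := H) M (-g)
    simpa [state, init] using this
  | succ i =>
    simp only [state_M_succ]
    exact norm_le_bump _ _

theorem inner_shift_r_le {i j : ℕ} (hij : i ≤ j) :
    ⟪(state H g ε M i).r, shift H ε (state H g ε M i).r⟫_ℝ ≤
      ((state H g ε M j).M + 2 * ε) * ‖(state H g ε M i).r‖ ^ 2 := by
  set r := (state H g ε M i).r
  have h1 := real_inner_le_norm r (H r)
  have h2 := mul_le_mul_of_nonneg_left (norm_apply_r_le (H := H) (g := g) (ε := ε) (M := M) hij)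
    (norm_nonneg r)
  rw [shift, inner_add_right, inner_smul_right, real_inner_self_eq_norm_sq]
  change ‖r‖ * ‖H r‖ ≤ ‖r‖ * (_ * ‖r‖) at h2
  nlinarith

/-- The method has not broken down before iteration `j`: nonzero residuals, and directions of
positive curvature. -/
def Regular (H : E n →L[ℝ] E n) (g : E n) (ε M : ℝ) (j : ℕ) : Prop :=
  ∀ i < j, (state H g ε M i).r ≠ 0 ∧
    0 < ⟪(state H g ε M i).p, shift H ε (state H g ε M i).p⟫_ℝ

theorem Regular.mono {i j : ℕ} (h : Regular H g ε M j) (hij : i ≤ j) : Regular H g ε M i :=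
  fun l hl => h l (hl.trans_le hij)

theorem alpha_pos {i j : ℕ} (h : Regular H g ε M j) (hij : i < j) :
    0 < alpha ε (state H g ε M i) := by
  rw [alpha_eq]
  have := norm_pos_iff.2 (h i hij).1
  exact div_pos (by positivity) (h i hij).2

/-- r^i is a combination of p^i and p^{i-1}, so orthogonality to directions passes to residuals. The
second hypothesis is vacuous for i = 0. -/
theorem r_eq_p (i : ℕ) (v : E n) (h : ⟪v, (state H g ε M i).p⟫_ℝ = 0)
    (h' : ∀ l, l + 1 = i → ⟪v, (state H g ε M l).p⟫_ℝ = 0) : ⟪v, (state H g ε M i).r⟫_ℝ = 0 := by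
  cases i with
  | zero => simpa [state, init] using h
  | succ i =>
    rw [state_p_succ, inner_add_right, inner_smul_right, h' i rfl, inner_neg_right] at h
    linarith

/-- Orthogonality of the residuals, conjugacy of the directions. -/
theorem orthogonality (hH : ∀ u v, ⟪H u, v⟫_ℝ = ⟪u, H v⟫_ℝ) (j : ℕ) (h : Regular H g ε M j) :
    (∀ i < j, ⟪(state H g ε M j).r, (state H g ε M i).p⟫_ℝ = 0) ∧
    (∀ i < j, ⟪(state H g ε M j).r, (state H g ε M i).r⟫_ℝ = 0) ∧
    (∀ i < j, ⟪(state H g ε M j).p, shift H ε (state H g ε M i).p⟫_ℝ = 0) ∧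
    ⟪(state H g ε M j).r, (state H g ε M j).p⟫_ℝ = -‖(state H g ε M j).r‖ ^ 2 := by
  induction j with
  | zero => simp [state, init]
  | succ j ih =>
    obtain ⟨h1, h2, h3, h4⟩ := ih (h.mono (Nat.le_succ j))
    obtain ⟨hr, hp⟩ := h j (Nat.lt_succ_self j)
    have hα := alpha_pos h (Nat.lt_succ_self j)
    have hr2 : ‖(state H g ε M j).r‖ ^ 2 ≠ 0 := by
      have := norm_pos_iff.2 hr
      positivity
    have rp : ∀ i < j + 1, ⟪(state H g ε M (j + 1)).r, (state H g ε M i).p⟫_ℝ = 0 := by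
      intro i hi
      rw [state_r_succ, inner_add_left, inner_smul_left]
      rcases Nat.lt_succ_iff_lt_or_eq.1 hi with hi | rfl
      · rw [h1 i hi, real_inner_comm, inner_shift_comm hH, h3 i hi]
        simp
      · rw [h4, real_inner_comm, alpha_eq]
        simp only [conj_trivial]
        rw [div_mul_cancel₀ _ hp.ne']
        ring
    have rr : ∀ i < j + 1, ⟪(state H g ε M (j + 1)).r, (state H g ε M i).r⟫_ℝ = 0 :=
      fun i hi => r_eq_p i _ (rp i hi) fun l hl => rp l (by omega)
    -- Conjugacy is tested after multiplying by α_i, because α_i H̄p^i is a difference of residuals,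
    -- to which orthogonality applies.
    have hsh : ∀ i, alpha ε (state H g ε M i) • shift H ε (state H g ε M i).p =
        (state H g ε M (i + 1)).r - (state H g ε M i).r := by
      intro i
      rw [state_r_succ]; abel
    refine ⟨rp, rr, ?_, ?_⟩
    · intro i hi
      have hαi := alpha_pos h hi
      have key : alpha ε (state H g ε M i) *
          ⟪(state H g ε M (j + 1)).p, shift H ε (state H g ε M i).p⟫_ℝ = 0 := by
        rw [state_p_succ, inner_add_left, inner_neg_left, inner_smul_left, mul_add, mul_neg,
          ← inner_smul_right, hsh, inner_sub_right, rr i hi]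
        rcases Nat.lt_succ_iff_lt_or_eq.1 hi with hi | rfl
        · rw [rr (i + 1) (by omega), h3 i hi]
          simp
        · rw [real_inner_self_eq_norm_sq, alpha_eq]
          simp only [conj_trivial]
          field_simp
          ring
      exact (mul_eq_zero.1 key).resolve_left hαi.ne'
    · rw [state_p_succ, inner_add_right, inner_neg_right, inner_smul_right, rp j (by omega),
        real_inner_self_eq_norm_sq]
      ring

/-- y^i is a combination of directions before p^i. For i = j this reads ⟨g, y⟩ = -⟨y, H̄y⟩, which
serves the residual bound and the Newton step alike. -/
theorem inner_r_y (hH : ∀ u v, ⟪H u, v⟫_ℝ = ⟪u, H v⟫_ℝ) {i j : ℕ} (h : Regular H g ε M j)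
    (hij : i ≤ j) : ⟪(state H g ε M j).r, (state H g ε M i).y⟫_ℝ = 0 := by
  induction i with
  | zero => simp [state, init]
  | succ i ih =>
    rw [state_y_succ, inner_add_right, inner_smul_right, ih (by omega),
      (orthogonality hH j h).1 i hij]
    simp

/-- In dimension `n` the residual vanishes, or the method breaks down, within `n` steps. -/
theorem Regular.le_dim (hH : ∀ u v, ⟪H u, v⟫_ℝ = ⟪u, H v⟫_ℝ) {j : ℕ} (h : Regular H g ε M j) :
    j ≤ n := by
  have hli : LinearIndependent ℝ fun i : Fin j => (state H g ε M i).r := by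
    refine linearIndependent_of_ne_zero_of_inner_eq_zero (𝕜 := ℝ) (fun i => (h i i.2).1) ?_
    intro a b hab
    rcases lt_or_gt_of_ne (fun e => hab (Fin.ext e) : (a : ℕ) ≠ b) with hlt | hlt
    · change ⟪(state H g ε M a).r, (state H g ε M b).r⟫_ℝ = 0
      rw [real_inner_comm]
      exact (orthogonality hH b (h.mono b.2.le)).2.1 a hlt
    · exact (orthogonality hH a (h.mono a.2.le)).2.1 b hlt
  simpa using hli.fintype_card_le_finrank

/-- `⟨p, H̄p⟩ ≤ ⟨r, H̄r⟩`. -/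
theorem inner_shift_p_le (hH : ∀ u v, ⟪H u, v⟫_ℝ = ⟪u, H v⟫_ℝ) {j : ℕ}
    (h : Regular H g ε M j) :
    ⟪(state H g ε M j).p, shift H ε (state H g ε M j).p⟫_ℝ ≤
      ⟪(state H g ε M j).r, shift H ε (state H g ε M j).r⟫_ℝ := by
  cases j with
  | zero => simp [state, init, shift_neg]
  | succ j =>
    obtain ⟨-, -, h3, -⟩ := orthogonality hH (j + 1) h
    have h3 := h3 j (Nat.lt_succ_self j)
    -- With r = -p + b p' and p, p' conjugate, ⟨r, H̄r⟩ exceeds ⟨p, H̄p⟩ by b²⟨p', H̄p'⟩ ≥ 0.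
    obtain ⟨b, hb⟩ : ∃ b : ℝ, (state H g ε M (j + 1)).r =
        -(state H g ε M (j + 1)).p + b • (state H g ε M j).p :=
      ⟨_, by rw [state_p_succ]; abel⟩
    have h3' := h3
    rw [inner_shift_comm hH] at h3'
    rw [hb]
    simp only [shift_add, shift_neg, shift_smul, inner_add_left, inner_add_right, inner_neg_left,
      inner_neg_right, inner_smul_left, inner_smul_right, h3, h3', conj_trivial]
    have := mul_nonneg (sq_nonneg b) (h j (Nat.lt_succ_self j)).2.le
    nlinarith

end Relations

/-! ### The residual decreases linearly as long as the curvature along the iterates is large -/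

/-- One contraction of the potential φ(y) - φ(x) + (ε/2)‖x - v‖². An accelerated method couples y
and v to control the terms in r; for conjugate gradients r is orthogonal to both, so no coupling is
needed. Expanding the square leaves (a²/2ε)‖r‖², which the decrease ‖r‖²/(2L) absorbs because a²L ≤
ε. -/
theorem estimate_step {V : Type*} [NormedAddCommGroup V] [InnerProductSpace ℝ V]
    {x y v r : V} {ε a φy φy' φx L : ℝ} (hε : 0 < ε) (hL : 0 < L) (ha0 : 0 ≤ a) (ha1 : a ≤ 1)
    (haL : a ^ 2 * L ≤ ε) (hrv : ⟪r, v⟫_ℝ = 0) (hry : ⟪r, y⟫_ℝ = 0)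
    (hc : φy + ⟪r, x - y⟫_ℝ + ε / 2 * ‖x - y‖ ^ 2 ≤ φx)
    (hd : φy' ≤ φy - ‖r‖ ^ 2 / (2 * L)) :
    φy' - φx + ε / 2 * ‖x - ((1 - a) • v + a • y - (a / ε) • r)‖ ^ 2 ≤
      (1 - a) * (φy - φx + ε / 2 * ‖x - v‖ ^ 2) := by
  have e : x - ((1 - a) • v + a • y - (a / ε) • r) =
      ((1 - a) • (x - v) + a • (x - y)) + (a / ε) • r := by module
  have hp : ⟪r, x - v⟫_ℝ = ⟪r, x⟫_ℝ := by rw [inner_sub_right, hrv, sub_zero]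
  have hq : ⟪r, x - y⟫_ℝ = ⟪r, x⟫_ℝ := by rw [inner_sub_right, hry, sub_zero]
  have hs : ⟪r, (1 - a) • (x - v) + a • (x - y)⟫_ℝ = ⟪r, x⟫_ℝ := by
    rw [inner_add_right, inner_smul_right, inner_smul_right, hp, hq]; ring
  have hpq := norm_sub_sq_real (x - v) (x - y)
  have hpq0 := sq_nonneg ‖(x - v) - (x - y)‖
  rw [e, norm_add_sq_real, norm_add_sq_real]
  simp only [inner_smul_left, inner_smul_right, norm_smul, mul_pow, conj_trivial,
    real_inner_comm r, hs, Real.norm_eq_abs, sq_abs]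
  rw [hq] at hc
  have h1 : a ^ 2 / ε * ‖r‖ ^ 2 ≤ ‖r‖ ^ 2 / L := by
    rw [div_mul_eq_mul_div, div_le_div_iff₀ hε hL]
    nlinarith [sq_nonneg ‖r‖]
  have h2 : ‖r‖ ^ 2 / (2 * L) = ‖r‖ ^ 2 / L / 2 := by rw [mul_comm, div_div]
  rw [h2] at hd
  -- Convexity of the squared norm, with its defect a(1-a)‖v - y‖² dropped.
  have h3 : 0 ≤ a * (1 - a) * (ε / 2) := by
    have := sub_nonneg.2 ha1
    positivity
  have h4 := mul_nonneg h3 hpq0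
  rw [hpq] at h4
  have h5 := mul_le_mul_of_nonneg_left hc ha0
  have e1 : ε / 2 * ((1 - a) ^ 2 * ‖x - v‖ ^ 2 + 2 * (a * ((1 - a) * ⟪x - v, x - y⟫_ℝ)) +
      a ^ 2 * ‖x - y‖ ^ 2 + 2 * (a / ε * ⟪r, x⟫_ℝ) +
      (a / ε) ^ 2 * ‖r‖ ^ 2) = ε / 2 * ((1 - a) ^ 2 * ‖x - v‖ ^ 2 +
      2 * (a * ((1 - a) * ⟪x - v, x - y⟫_ℝ)) + a ^ 2 * ‖x - y‖ ^ 2) + a * ⟪r, x⟫_ℝ +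
      a ^ 2 / ε * ‖r‖ ^ 2 / 2 := by
    field_simp
  refine le_trans (le_of_eq (congrArg _ e1)) ?_
  nlinarith

/-- The quadratic model `½ zᵀH̄z + gᵀz`. -/
def model {n : ℕ} (H : E n →L[ℝ] E n) (g : E n) (ε : ℝ) (z : E n) : ℝ :=
  ⟪z, shift H ε z⟫_ℝ / 2 + ⟪g, z⟫_ℝ

section Decrease

variable {n : ℕ} {H : E n →L[ℝ] E n} {g : E n} {ε M : ℝ}

theorem model_expand (hH : ∀ u v, ⟪H u, v⟫_ℝ = ⟪u, H v⟫_ℝ) (x y : E n) :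
    model H g ε x = model H g ε y + ⟪g + shift H ε y, x - y⟫_ℝ +
      ⟪x - y, shift H ε (x - y)⟫_ℝ / 2 := by
  obtain ⟨d, rfl⟩ : ∃ d, x = y + d := ⟨x - y, by abel⟩
  simp only [model, add_sub_cancel_left, shift_add, inner_add_left, inner_add_right,
    inner_shift_comm hH y d, real_inner_comm d (shift H ε y)]
  ring

/-- Exact minimization along p gains ‖r‖⁴/(2⟨p, H̄p⟩), and ⟨p, H̄p⟩ ≤ ⟨r, H̄r⟩ ≤ L‖r‖². So the step
gains at least what a gradient step of length 1/L guarantees. -/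
theorem model_step (hH : ∀ u v, ⟪H u, v⟫_ℝ = ⟪u, H v⟫_ℝ) {j : ℕ} {L : ℝ} (hL : 0 < L)
    (h : Regular H g ε M (j + 1))
    (hLr : ⟪(state H g ε M j).r, shift H ε (state H g ε M j).r⟫_ℝ ≤
      L * ‖(state H g ε M j).r‖ ^ 2) :
    model H g ε (state H g ε M (j + 1)).y ≤
      model H g ε (state H g ε M j).y - ‖(state H g ε M j).r‖ ^ 2 / (2 * L) := by
  have h' := h.mono (Nat.le_succ j)
  obtain ⟨hr, hp⟩ := h j (Nat.lt_succ_self j)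
  have hle := (inner_shift_p_le hH h').trans hLr
  have hr0 : 0 < ‖(state H g ε M j).r‖ := norm_pos_iff.2 hr
  rw [model_expand hH _ (state H g ε M j).y, ← state_r_eq, state_y_succ, add_sub_cancel_left,
    shift_smul, inner_smul_left, inner_smul_right, inner_smul_right, (orthogonality hH j h').2.2.2,
    alpha_eq]
  simp only [conj_trivial]
  generalize ⟪(state H g ε M j).p, shift H ε (state H g ε M j).p⟫_ℝ = q at *
  generalize ‖(state H g ε M j).r‖ ^ 2 = ρ at *
  have hρ : 0 ≤ ρ := by
    by_contra hneg
    nlinarith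
  have key : ρ / (2 * L) ≤ ρ ^ 2 / (2 * q) := by
    rw [div_le_div_iff₀ (by positivity) (by positivity)]
    nlinarith
  have e : ρ / q * -ρ + ρ / q * (ρ / q * q) / 2 = -(ρ ^ 2 / (2 * q)) := by
    field_simp
    ring
  rw [add_assoc, e]
  linarith

/-- The centers of the estimating quadratics. -/
def center (H : E n →L[ℝ] E n) (g : E n) (ε M a : ℝ) : ℕ → E n
  | 0 => 0
  | j + 1 => (1 - a) • center H g ε M a j + a • (state H g ε M j).y -
      (a / ε) • (state H g ε M j).r

theorem inner_r_center (hH : ∀ u v, ⟪H u, v⟫_ℝ = ⟪u, H v⟫_ℝ) {a : ℝ} {i j : ℕ}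
    (h : Regular H g ε M j) (hij : i ≤ j) :
    ⟪(state H g ε M j).r, center H g ε M a i⟫_ℝ = 0 := by
  induction i with
  | zero => simp [center]
  | succ i ih =>
    rw [center, inner_sub_right, inner_add_right, inner_smul_right, inner_smul_right,
      inner_smul_right, ih (by omega), inner_r_y hH h (by omega),
      (orthogonality hH j h).2.1 i hij]
    simp

/-- The potential of `estimate_step`, with comparison point x = y^{j+1}, shrinks by 1 - a in each of
the first j steps. Step j itself lowers the model by ‖r^j‖²/(2L), so the gap left between y^j and x
bounds the residual. -/
theorem residual_bound (hH : ∀ u v, ⟪H u, v⟫_ℝ = ⟪u, H v⟫_ℝ) (hε : 0 < ε) {a L : ℝ}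
    (ha0 : 0 ≤ a) (ha1 : a ≤ 1) (hL : 0 < L) (haL : a ^ 2 * L ≤ ε) {j : ℕ} (hj : 1 ≤ j)
    (h : Regular H g ε M (j + 1))
    (hLr : ∀ i ≤ j, ⟪(state H g ε M i).r, shift H ε (state H g ε M i).r⟫_ℝ ≤
      L * ‖(state H g ε M i).r‖ ^ 2)
    (hcurv : ∀ i < j, ε * ‖(state H g ε M (j + 1)).y - (state H g ε M i).y‖ ^ 2 ≤
      ⟪(state H g ε M (j + 1)).y - (state H g ε M i).y,
        shift H ε ((state H g ε M (j + 1)).y - (state H g ε M i).y)⟫_ℝ) :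
    ‖(state H g ε M j).r‖ ^ 2 ≤ 2 * L * ((1 - a) ^ j * (‖g‖ ^ 2 / ε)) := by
  set x := (state H g ε M (j + 1)).y with hx
  have hy0 : (state H g ε M 0).y = 0 := rfl
  have main : ∀ s ≤ j, model H g ε (state H g ε M s).y - model H g ε x +
      ε / 2 * ‖x - center H g ε M a s‖ ^ 2 ≤
      (1 - a) ^ s * (ε / 2 * ‖x‖ ^ 2 - model H g ε x) := by
    intro s
    induction s with
    | zero =>
      intro _
      have : model H g ε (0 : E n) = 0 := by simp [model]
      rw [hy0, this, center]
      simp only [sub_zero, pow_zero, one_mul]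
      linarith
    | succ s ih =>
      intro hs
      have hreg : Regular H g ε M s := h.mono (by omega)
      have h1 := ih (by omega)
      refine le_trans (estimate_step hε hL ha0 ha1 haL (inner_r_center hH hreg le_rfl)
        (inner_r_y hH hreg le_rfl) ?_
        (model_step hH hL (h.mono (by omega)) (hLr s (by omega)))) ?_
      · rw [model_expand hH x (state H g ε M s).y, ← state_r_eq]
        have := hcurv s hs
        linarith
      · rw [pow_succ' (1 - a), mul_assoc]
        exact mul_le_mul_of_nonneg_left h1 (by linarith)
  have h1 := main j le_rfl
  have h2 := model_step hH hL h (hLr j le_rfl)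
  have hc0 := hcurv 0 hj
  rw [hy0, sub_zero] at hc0
  have hrx : ⟪g, x⟫_ℝ + ⟪x, shift H ε x⟫_ℝ = 0 := by
    have := inner_r_y hH h le_rfl
    rw [state_r_eq, inner_add_left, real_inner_comm x (shift H ε _)] at this
    exact this
  have hcs : -⟪g, x⟫_ℝ ≤ ‖g‖ * ‖x‖ := by
    have := (abs_le.1 (abs_real_inner_le_norm g x)).1
    linarith
  have hxg : ε * ‖x‖ ≤ ‖g‖ := by
    rcases eq_or_lt_of_le (norm_nonneg x) with h0 | h0
    · rw [← h0, mul_zero]; exact norm_nonneg g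
    · refine le_of_mul_le_mul_right ?_ h0
      nlinarith
  have hq : ⟪x, shift H ε x⟫_ℝ ≤ ‖g‖ ^ 2 / ε := by
    rw [le_div_iff₀ hε]
    have := mul_le_mul_of_nonneg_left hxg (norm_nonneg g)
    nlinarith
  -- Since ⟨r^{j+1}, x⟩ = 0, the model at x is -⟨x, H̄x⟩/2; the curvature hypothesis with i = 0,
  -- available as j ≥ 1, bounds the other term by the same quantity.
  have h3 : ε / 2 * ‖x‖ ^ 2 - model H g ε x ≤ ‖g‖ ^ 2 / ε := by
    rw [model]
    linarith
  have h4 : ‖(state H g ε M j).r‖ ^ 2 / (2 * L) ≤ (1 - a) ^ j * (‖g‖ ^ 2 / ε) := by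
    have h5 := mul_le_mul_of_nonneg_left h3 (pow_nonneg (sub_nonneg.2 ha1) j)
    have h6 : 0 ≤ ε / 2 * ‖x - center H g ε M a j‖ ^ 2 := by positivity
    rw [← hx] at h2
    linarith
  rw [div_le_iff₀ (by positivity)] at h4
  linarith

end Decrease

/-! ### The constants of the capped method -/

section Constants

variable {M ε : ℝ}

theorem two_le_kappa (hε : 0 < ε) (hM : 0 ≤ M) : 2 ≤ kappa M ε := by
  rw [kappa, le_div_iff₀ hε]; linarith

theorem tau_pos (hε : 0 < ε) (hM : 0 ≤ M) : 0 < tau M ε := by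
  have := two_le_kappa hε hM
  have : 0 < √(kappa M ε) := Real.sqrt_pos.2 (by linarith)
  unfold tau; positivity

theorem one_sub_tau (M ε : ℝ) : 1 - tau M ε = 1 / (√(kappa M ε) + 1) := by
  have := Real.sqrt_nonneg (kappa M ε)
  unfold tau
  field_simp
  ring

theorem tau_lt_one (M ε : ℝ) : tau M ε < 1 := by
  have := Real.sqrt_nonneg (kappa M ε)
  have h : 0 < 1 / (√(kappa M ε) + 1) := by positivity
  rw [← one_sub_tau] at h
  linarith

theorem sqrt_tau_lt_one (M ε : ℝ) : √(tau M ε) < 1 := by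
  rw [Real.sqrt_lt' one_pos]; simpa using tau_lt_one M ε

theorem kappa_mono (hε : 0 < ε) {M' : ℝ} (h : M ≤ M') : kappa M ε ≤ kappa M' ε := by
  unfold kappa
  gcongr

theorem tau_mono (hε : 0 < ε) {M' : ℝ} (h : M ≤ M') : tau M ε ≤ tau M' ε := by
  have h1 := one_sub_tau M ε
  have h2 := one_sub_tau M' ε
  have h3 := Real.sqrt_le_sqrt (kappa_mono hε h)
  have h4 := Real.sqrt_nonneg (kappa M ε)
  have : 1 / (√(kappa M' ε) + 1) ≤ 1 / (√(kappa M ε) + 1) := by gcongr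
  linarith

theorem capT_mono (hε : 0 < ε) (hM : 0 ≤ M) {M' : ℝ} (h : M ≤ M') :
    capT M ε ≤ capT M' ε := by
  have h1 := kappa_mono hε h
  have h2 := two_le_kappa hε hM
  have h3 := Real.sqrt_le_sqrt (tau_mono hε h)
  have h4 := sub_pos.2 (sqrt_tau_lt_one M' ε)
  unfold capT
  gcongr

theorem zetaHat_anti (hε : 0 < ε) (hM : 0 ≤ M) {M' ζr : ℝ} (hζ : 0 ≤ ζr) (h : M ≤ M') :
    zetaHat M' ε ζr ≤ zetaHat M ε ζr := by
  have h1 := kappa_mono hε h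
  have h2 := two_le_kappa hε hM
  unfold zetaHat
  gcongr

theorem zetaHat_pos (hε : 0 < ε) (hM : 0 ≤ M) {ζr : ℝ} (hζ : 0 < ζr) : 0 < zetaHat M ε ζr := by
  have h2 := two_le_kappa hε hM
  unfold zetaHat
  positivity

theorem zetaHat_lt_one (hε : 0 < ε) (hM : 0 ≤ M) {ζr : ℝ} (hζ : ζr < 1) : zetaHat M ε ζr < 1 := by
  have h2 := two_le_kappa hε hM
  rw [zetaHat, div_lt_one (by positivity)]
  linarith

/-- 2κ is the factor that `residual_bound` delivers; T is far larger. -/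
theorem two_kappa_le_capT (hε : 0 < ε) (hM : 0 ≤ M) : 2 * kappa M ε ≤ capT M ε := by
  have h2 := two_le_kappa hε hM
  have h4 := sub_pos.2 (sqrt_tau_lt_one M ε)
  have h5 : 1 - √(tau M ε) ≤ 1 := by linarith [Real.sqrt_nonneg (tau M ε)]
  rw [capT, le_div_iff₀ (by positivity)]
  have h6 : (1 - √(tau M ε)) ^ 2 ≤ 1 := pow_le_one₀ h4.le h5
  have h7 : (1 : ℝ) ≤ kappa M ε ^ 3 := one_le_pow₀ (by linarith)
  nlinarith

theorem one_le_sqrt_capT (hε : 0 < ε) (hM : 0 ≤ M) : 1 ≤ √(capT M ε) := by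
  rw [Real.one_le_sqrt]
  linarith [two_kappa_le_capT hε hM, two_le_kappa hε hM]

/-- M may grow during a call, whereas J is formed with the final upper bound; this compares the two
thresholds. -/
theorem slowFactor_mono (hε : 0 < ε) (hM : 0 ≤ M) {M' : ℝ} (h : M ≤ M') (j : ℕ) :
    √(capT M ε) * tau M ε ^ ((j : ℝ) / 2) ≤ √(capT M' ε) * tau M' ε ^ ((j : ℝ) / 2) := by
  have h1 := Real.sqrt_le_sqrt (capT_mono hε hM h)
  have h2 := Real.rpow_le_rpow (tau_pos hε hM).le (tau_mono hε h) (by positivity : 0 ≤ (j : ℝ) / 2)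
  have := Real.rpow_nonneg (tau_pos hε hM).le ((j : ℝ) / 2)
  gcongr

theorem slowFactor_sq (hε : 0 < ε) (hM : 0 ≤ M) (j : ℕ) :
    (√(capT M ε) * tau M ε ^ ((j : ℝ) / 2)) ^ 2 = capT M ε * tau M ε ^ j := by
  have h : 0 ≤ capT M ε := by linarith [two_kappa_le_capT hε hM, two_le_kappa hε hM]
  rw [mul_pow, Real.sq_sqrt h, ← Real.rpow_natCast (tau M ε ^ ((j : ℝ) / 2)) 2,
    ← Real.rpow_mul (tau_pos hε hM).le, ← Real.rpow_natCast _ j]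
  congr 2
  push_cast
  ring

theorem capJ_spec (hε : 0 < ε) (hM : 0 ≤ M) {ζr cμ R : ℝ} (hζ : 0 < ζr) (hc : 0 < cμ)
    (hR : 0 < R) :
    √(capT M ε) * tau M ε ^ ((capJ M ε ζr cμ R : ℝ) / 2) * R ≤
      min (zetaHat M ε ζr * R) cμ := by
  -- Without this the infimum of naturals could be the default value 0. A suitable exponent exists
  -- because √τ < 1.
  have hne : {J : ℕ | √(capT M ε) * tau M ε ^ ((J : ℝ) / 2) * R ≤
      min (zetaHat M ε ζr * R) cμ}.Nonempty := by
    have hpos : 0 < min (zetaHat M ε ζr * R) cμ :=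
      lt_min (mul_pos (zetaHat_pos hε hM hζ) hR) hc
    have hT := one_le_sqrt_capT hε hM
    have hs0 := Real.sqrt_nonneg (tau M ε)
    obtain ⟨J, hJ⟩ := exists_pow_lt_of_lt_one (div_pos hpos (mul_pos (by linarith) hR) :
      0 < min (zetaHat M ε ζr * R) cμ / (√(capT M ε) * R)) (sqrt_tau_lt_one M ε)
    refine ⟨J, ?_⟩
    rw [lt_div_iff₀ (by positivity)] at hJ
    have e : tau M ε ^ ((J : ℝ) / 2) = √(tau M ε) ^ J := by
      rw [Real.sqrt_eq_rpow, ← Real.rpow_natCast, ← Real.rpow_mul (tau_pos hε hM).le]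
      congr 1
      ring
    rw [Set.mem_ofPred_eq]
    rw [e]
    linarith
  exact Nat.sInf_mem hne

/-- Exponent 0 would require √T ≤ ζ̂_r, but √T ≥ 1 > ζ̂_r. It is needed so that 2 min(n, J) covers
the single product of a call that stops at p⁰. -/
theorem one_le_capJ (hε : 0 < ε) (hM : 0 ≤ M) {ζr cμ R : ℝ} (hζ : 0 < ζr) (hζ1 : ζr < 1)
    (hc : 0 < cμ) (hR : 0 < R) : 1 ≤ capJ M ε ζr cμ R := by
  by_contra hlt
  have h0 : capJ M ε ζr cμ R = 0 := by omega
  have h := capJ_spec hε hM hζ hc hR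
  rw [h0] at h
  have h1 := h.trans (min_le_left _ _)
  simp only [Nat.cast_zero, zero_div, Real.rpow_zero, mul_one] at h1
  have h2 := le_of_mul_le_mul_right h1 hR
  linarith [zetaHat_lt_one hε hM hζ1, one_le_sqrt_capT hε hM]

end Constants

/-! ### Correctness and cost of the capped method -/

theorem supNorm_zero {n : ℕ} : supNorm (0 : E n) = 0 := by simp [supNorm]

theorem lowCurv_iff {n : ℕ} {H : E n →L[ℝ] E n} {ε : ℝ} {v : E n} :
    LowCurv ε (H v) v ↔ ⟪v, shift H ε v⟫_ℝ < ε * ‖v‖ ^ 2 := Iff.rfl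

section Spec

variable {n : ℕ} {H : E n →L[ℝ] E n} {g : E n} {ε ζr cμ M : ℝ}

theorem stops_zero : Stops H g ε ζr cμ M 0 ↔
    LowCurv ε (H (state H g ε M 0).p) (state H g ε M 0).p := by
  rw [Stops, if_pos rfl, (state_products 0).2.2]

theorem stops_pos {j : ℕ} (hj : j ≠ 0) : Stops H g ε ζr cμ M j ↔
    LowCurv ε (H (state H g ε M j).y) (state H g ε M j).y ∨
      Solved g ε ζr cμ (state H g ε M j) ∨
      LowCurv ε (H (state H g ε M j).p) (state H g ε M j).p ∨
      Slow g ε j (state H g ε M j) := by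
  rw [Stops, if_neg hj, (state_products j).2.2, (state_products j).1]

theorem solved_of_r_eq_zero (hε : 0 < ε) (hM : 0 ≤ M) (hζ : 0 < ζr) (hc : 0 < cμ) {j : ℕ}
    (h : (state H g ε M j).r = 0) : Solved g ε ζr cμ (state H g ε M j) := by
  have := zetaHat_pos hε (hM.trans (le_state_M (H := H) (g := g) (ε := ε) j)) hζ
  rw [Solved, h, norm_zero, supNorm_zero]
  exact ⟨by positivity, hc.le⟩

/-- Failing the low-curvature test gives strict positivity only if p ≠ 0, and ⟨r, p⟩ = -‖r‖²
excludes p = 0. -/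
theorem inner_shift_p_pos (hH : ∀ u v, ⟪H u, v⟫_ℝ = ⟪u, H v⟫_ℝ) (hε : 0 < ε) {j : ℕ}
    (h : Regular H g ε M j) (hr : (state H g ε M j).r ≠ 0)
    (hp : ¬ LowCurv ε (H (state H g ε M j).p) (state H g ε M j).p) :
    0 < ⟪(state H g ε M j).p, shift H ε (state H g ε M j).p⟫_ℝ := by
  have hp0 : (state H g ε M j).p ≠ 0 := by
    intro h0
    have h4 := (orthogonality hH j h).2.2.2
    rw [h0, inner_zero_right] at h4
    have := norm_pos_iff.2 hr
    nlinarith [pow_pos this 2]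
  rw [lowCurv_iff, not_lt] at hp
  have := norm_pos_iff.2 hp0
  exact lt_of_lt_of_le (by positivity) hp

theorem regular_of_not_stops (hH : ∀ u v, ⟪H u, v⟫_ℝ = ⟪u, H v⟫_ℝ) (hε : 0 < ε) (hM : 0 ≤ M)
    (hζ : 0 < ζr) (hc : 0 < cμ) (hg : g ≠ 0) {j : ℕ} (h : ∀ i < j, ¬ Stops H g ε ζr cμ M i) :
    Regular H g ε M j := by
  induction j with
  | zero => intro i hi; omega
  | succ j ih =>
    have hj := ih fun i hi => h i (by omega)
    intro i hi
    rcases Nat.lt_succ_iff_lt_or_eq.1 hi with hi | rfl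
    · exact hj i hi
    have hs := h i (Nat.lt_succ_self i)
    rcases Nat.eq_zero_or_pos i with rfl | hpos
    · rw [stops_zero] at hs
      exact ⟨hg, inner_shift_p_pos hH hε hj hg hs⟩
    · rw [stops_pos hpos.ne'] at hs
      push Not at hs
      have hr : (state H g ε M i).r ≠ 0 := fun h0 => hs.2.1 (solved_of_r_eq_zero hε hM hζ hc h0)
      exact ⟨hr, inner_shift_p_pos hH hε hj hr hs.2.2.1⟩

theorem exists_stops_le_dim (hH : ∀ u v, ⟪H u, v⟫_ℝ = ⟪u, H v⟫_ℝ) (hε : 0 < ε) (hM : 0 ≤ M)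
    (hζ : 0 < ζr) (hc : 0 < cμ) (hg : g ≠ 0) : ∃ j ≤ n, Stops H g ε ζr cμ M j := by
  by_contra! h
  have := (regular_of_not_stops hH hε hM hζ hc hg (j := n + 1)
    fun i hi => h i (by omega)).le_dim hH
  omega

/-- If iteration J is reached without being slow, the residual is below √T τ^{J/2}‖g‖, even with M
replaced by its upper bound. Both parts of the solution test follow: the first is homogeneous in R,
the second only gets easier when R shrinks to ‖g‖, and ζ̂_r decreases in M. -/
theorem exists_stops_le_capJ (hε : 0 < ε) (hM : 0 ≤ M) (hζ : 0 < ζr) (hζ1 : ζr < 1)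
    (hc : 0 < cμ) (hg : g ≠ 0) {B R : ℝ} (hB : MBounded H g ε ζr cμ M B) (hR : ‖g‖ ≤ R) :
    ∃ j ≤ capJ B ε ζr cμ R, Stops H g ε ζr cμ M j := by
  by_contra! h
  have hg0 := norm_pos_iff.2 hg
  have hR0 : 0 < R := hg0.trans_le hR
  have hB0 : 0 ≤ B := hM.trans hB.1
  have h1 := one_le_capJ hε hB0 hζ hζ1 hc hR0
  have hspec := capJ_spec hε hB0 hζ hc hR0
  set J := capJ B ε ζr cμ R
  have hJ := h J le_rfl
  rw [stops_pos (by omega)] at hJ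
  push Not at hJ
  obtain ⟨-, hns, -, hsl⟩ := hJ
  have hMJ : (state H g ε M J).M ≤ B :=
    hB.2 J (h 0 (Nat.zero_le _)) fun i hi => h i hi.le
  have hM0 : 0 ≤ (state H g ε M J).M := hM.trans (le_state_M J)
  rw [Slow, not_lt] at hsl
  have h2 := slowFactor_mono hε hM0 hMJ J
  set F := √(capT B ε) * tau B ε ^ ((J : ℝ) / 2)
  have h3 : ‖(state H g ε M J).r‖ ≤ F * ‖g‖ :=
    hsl.trans (mul_le_mul_of_nonneg_right h2 hg0.le)
  have hF0 : 0 ≤ F := mul_nonneg (Real.sqrt_nonneg _) (Real.rpow_nonneg (tau_pos hε hB0).le _)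
  apply hns
  refine ⟨h3.trans (mul_le_mul_of_nonneg_right ?_ hg0.le), ?_⟩
  · exact (le_of_mul_le_mul_right (hspec.trans (min_le_left _ _)) hR0).trans
      (zetaHat_anti hε hM0 hζ.le hMJ)
  · exact (supNorm_le_norm _).trans (h3.trans ((mul_le_mul_of_nonneg_left hR hF0).trans
      (hspec.trans (min_le_right _ _))))

/-- Were no index available, `residual_bound` would contradict slowness. -/
theorem weakIndices_nonempty (hH : ∀ u v, ⟪H u, v⟫_ℝ = ⟪u, H v⟫_ℝ) (hε : 0 < ε) (hM : 0 ≤ M)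
    {j : ℕ} (hj : 1 ≤ j) (h : Regular H g ε M (j + 1)) (hs : Slow g ε j (state H g ε M j)) :
    (weakIndices H g ε M j).Nonempty := by
  by_contra hemp
  rw [Set.not_nonempty_iff_eq_empty] at hemp
  have hM0 : 0 ≤ (state H g ε M j).M := hM.trans (le_state_M j)
  set K := kappa (state H g ε M j).M ε with hK
  have hK2 : 2 ≤ K := two_le_kappa hε hM0
  have hsK : 0 < √K := Real.sqrt_pos.2 (by linarith)
  have hKL : (state H g ε M j).M + 2 * ε = K * ε := by
    rw [hK, kappa, div_mul_cancel₀ _ hε.ne']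
  have ha : 1 - 1 / (√K + 1) = tau (state H g ε M j).M ε := by
    have := one_sub_tau (state H g ε M j).M ε
    rw [← hK] at this
    linarith
  -- L = κε is M + 2ε for the current M, and a = 1/(√κ + 1) makes 1 - a = τ, while a²κ ≤ 1.
  have hb := residual_bound (a := 1 / (√K + 1)) (L := K * ε) hH hε (by positivity)
    (by rw [div_le_one (by positivity)]; linarith) (by positivity) (by
      rw [div_pow, one_pow, div_mul_eq_mul_div, one_mul, div_le_iff₀ (by positivity)]
      have := Real.sq_sqrt (by linarith : 0 ≤ K)
      nlinarith) hj h (fun i hi => hKL ▸ inner_shift_r_le hi) (fun i hi => by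
      by_contra hlt
      rw [not_le] at hlt
      have : i ∈ weakIndices H g ε M j := by
        refine ⟨hi, ?_⟩
        have e : (state H g ε M j).Hy + alpha ε (state H g ε M j) • (state H g ε M j).Hp -
            (state H g ε M i).Hy = H (nextY ε (state H g ε M j) - (state H g ε M i).y) := by
          simp [nextY, (state_products j).1, (state_products j).2.2, (state_products i).1]
        rw [e, lowCurv_iff]
        exact hlt
      rw [hemp] at this
      exact this)
  rw [ha] at hb
  rw [Slow] at hs
  have hτ := tau_pos hε hM0
  have h1 := pow_lt_pow_left₀ hs (by positivity) two_ne_zero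
  rw [mul_pow, slowFactor_sq hε hM0] at h1
  have h2 : 2 * (K * ε) * (tau (state H g ε M j).M ε ^ j * (‖g‖ ^ 2 / ε)) =
      2 * K * (tau (state H g ε M j).M ε ^ j * ‖g‖ ^ 2) := by
    field_simp
  rw [h2] at hb
  have h3 := mul_le_mul_of_nonneg_right (two_kappa_le_capT hε hM0)
    (by positivity : 0 ≤ tau (state H g ε M j).M ε ^ j * ‖g‖ ^ 2)
  linarith

/-- What the search direction returned by capped conjugate gradients satisfies. -/
def ValidOutput (H : E n →L[ℝ] E n) (g : E n) (ε cμ : ℝ) (o : Output n) : Prop :=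
  match o.dtype with
  | .nc => LowCurv ε (H o.d) o.d
  | .sol => o.d ≠ 0 ∧ ¬ LowCurv ε (H o.d) o.d ∧ ⟪g, o.d⟫_ℝ = -⟪o.d, shift H ε o.d⟫_ℝ ∧
      supNorm (g + shift H ε o.d) ≤ cμ

/-- A stop at j ≥ 1 costs j + 1 ≤ 2j products, or (j + 1) + (j - 1) = 2j if iterates are
regenerated; a stop at j = 0 costs one. -/
theorem run_spec (hH : ∀ u v, ⟪H u, v⟫_ℝ = ⟪u, H v⟫_ℝ) (hε : 0 < ε) (hM : 0 ≤ M)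
    (hζ : 0 < ζr) (hζ1 : ζr < 1) (hc : 0 < cμ) (hg : g ≠ 0) {B : ℝ}
    (hB : MBounded H g ε ζr cμ M B) {pick : Set ℕ → ℕ} (hpick : ∀ S, S.Nonempty → pick S ∈ S) :
    ∃ o, run pick H g ε ζr cμ M = some o ∧ ValidOutput H g ε cμ o ∧
      ∀ R, ‖g‖ ≤ R → o.products ≤ 2 * min n (capJ B ε ζr cμ R) := by
  classical
  obtain ⟨jn, hjn, hS⟩ := exists_stops_le_dim hH hε hM hζ hc hg
  have hex : ∃ j, Stops H g ε ζr cμ M j := ⟨jn, hS⟩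
  rw [run, dif_pos hex]
  have hn0 : 1 ≤ n := by
    rcases Nat.eq_zero_or_pos n with rfl | h
    · exact absurd (Subsingleton.elim g 0) hg
    · exact h
  have hbound : ∀ R, ‖g‖ ≤ R → Nat.find hex ≤ min n (capJ B ε ζr cμ R) ∧
      1 ≤ min n (capJ B ε ζr cμ R) := by
    intro R hR
    obtain ⟨jc, hjc, hSc⟩ := exists_stops_le_capJ hε hM hζ hζ1 hc hg hB hR
    exact ⟨le_min ((Nat.find_min' hex hS).trans hjn) ((Nat.find_min' hex hSc).trans hjc),
      le_min hn0 (one_le_capJ hε (hM.trans hB.1) hζ hζ1 hc ((norm_pos_iff.2 hg).trans_le hR))⟩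
  have hfind := Nat.find_spec hex
  have hreg : Regular H g ε M (Nat.find hex) :=
    regular_of_not_stops hH hε hM hζ hc hg fun i hi => Nat.find_min hex hi
  generalize Nat.find hex = j at *
  obtain ⟨hHy, -, hHp⟩ := state_products (H := H) (g := g) (ε := ε) (M := M) j
  by_cases hj : j = 0
  · subst hj
    rw [stops_zero] at hfind
    refine ⟨⟨.nc, (state H g ε M 0).p, 1⟩, by rw [output, if_pos rfl], hfind, fun R hR => ?_⟩
    have := hbound R hR
    change 1 ≤ _
    omega
  have hprod : ∀ R, ‖g‖ ≤ R → j + 1 ≤ 2 * min n (capJ B ε ζr cμ R) := by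
    intro R hR
    have := hbound R hR
    omega
  simp only [output, if_neg hj, hHy, hHp]
  rw [stops_pos hj] at hfind
  split_ifs with h1 h2 h3 h4
  · exact ⟨_, rfl, h1, hprod⟩
  · refine ⟨_, rfl, ⟨?_, h1, ?_, ?_⟩, hprod⟩
    -- y = 0 would leave the residual g, and ‖g‖ ≤ ζ̂_r‖g‖ is impossible.
    · intro h0
      change (state H g ε M j).y = 0 at h0
      have hr := h2.1
      have hz := zetaHat_lt_one hε (hM.trans (le_state_M (H := H) (g := g) (ε := ε) j)) hζ1
      have hz' := mul_lt_mul_of_pos_right hz (norm_pos_iff.2 hg)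
      rw [state_r_eq, h0] at hr
      simp [shift] at hr
      linarith
    · have := inner_r_y hH hreg le_rfl
      rw [state_r_eq, inner_add_left, real_inner_comm _ (shift H ε _)] at this
      change ⟪g, (state H g ε M j).y⟫_ℝ =
        -⟪(state H g ε M j).y, shift H ε (state H g ε M j).y⟫_ℝ
      linarith
    · have := h2.2
      rw [state_r_eq] at this
      exact this
  · exact ⟨_, rfl, h3, hprod⟩
  · refine ⟨_, rfl, ?_, fun R hR => ?_⟩
    · obtain ⟨-, hlow⟩ := hpick _ h4
      have e : (state H g ε M j).Hy + alpha ε (state H g ε M j) • (state H g ε M j).Hp -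
          (state H g ε M (pick (weakIndices H g ε M j))).Hy =
          H (nextY ε (state H g ε M j) - (state H g ε M (pick (weakIndices H g ε M j))).y) := by
        simp [nextY, (state_products j).1, (state_products j).2.2,
          (state_products (pick (weakIndices H g ε M j))).1]
      change LowCurv ε _ _ at hlow
      rw [e] at hlow
      exact hlow
    · have := hbound R hR
      change j + 1 + (j - 1) ≤ _
      omega
  · exfalso
    have hslow : Slow g ε j (state H g ε M j) := by tauto
    have hr : (state H g ε M j).r ≠ 0 := fun h0 => h2 (solved_of_r_eq_zero hε hM hζ hc h0)
    refine h4 (weakIndices_nonempty hH hε hM (Nat.one_le_iff_ne_zero.2 hj) ?_ hslow)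
    intro i hi
    rcases Nat.lt_succ_iff_lt_or_eq.1 hi with hi | rfl
    · exact hreg i hi
    · exact ⟨hr, inner_shift_p_pos hH hε hreg hr h3⟩

end Spec

end CG

/-! ### Taylor expansions with a Lipschitz continuous Hessian -/

section Taylor

variable {n : ℕ} {f : E n → ℝ} {Ω : Set (E n)} {LH : ℝ}

theorem hasGradientAt_of_contDiffOn (hΩ : IsOpen Ω) (hf : ContDiffOn ℝ 2 f Ω) {x : E n}
    (hx : x ∈ Ω) : HasGradientAt f (∇ f x) x :=
  ((hf.contDiffAt (hΩ.mem_nhds hx)).differentiableAt (by norm_num)).hasGradientAt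

theorem differentiableAt_fderiv_of_contDiffOn (hΩ : IsOpen Ω) (hf : ContDiffOn ℝ 2 f Ω) {x : E n}
    (hx : x ∈ Ω) : DifferentiableAt ℝ (fderiv ℝ f) x :=
  ((hf.contDiffAt (hΩ.mem_nhds hx)).fderiv_right (m := 1) (by norm_num)).differentiableAt
    (by norm_num)

theorem hasFDerivAt_gradient (hΩ : IsOpen Ω) (hf : ContDiffOn ℝ 2 f Ω) {x : E n}
    (hx : x ∈ Ω) : HasFDerivAt (∇ f) (hess f x) x := by
  refine DifferentiableAt.hasFDerivAt ?_
  exact ((InnerProductSpace.toDual ℝ (E n)).symm.toContinuousLinearEquiv.differentiableAt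
    (x := fderiv ℝ f x)).comp x (differentiableAt_fderiv_of_contDiffOn hΩ hf hx)

theorem inner_hess (hΩ : IsOpen Ω) (hf : ContDiffOn ℝ 2 f Ω) {x : E n}
    (hx : x ∈ Ω) (u v : E n) : ⟪hess f x u, v⟫_ℝ = fderiv ℝ (fderiv ℝ f) x u v := by
  have h1 : HasFDerivAt (∇ f) _ x :=
    ((InnerProductSpace.toDual ℝ (E n)).symm.toContinuousLinearEquiv.hasFDerivAt
    (x := fderiv ℝ f x)).comp x (differentiableAt_fderiv_of_contDiffOn hΩ hf hx).hasFDerivAt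
  rw [(hasFDerivAt_gradient hΩ hf hx).unique h1]
  exact InnerProductSpace.toDual_symm_apply

theorem inner_hess_comm (hΩ : IsOpen Ω) (hf : ContDiffOn ℝ 2 f Ω) {x : E n}
    (hx : x ∈ Ω) (u v : E n) : ⟪hess f x u, v⟫_ℝ = ⟪u, hess f x v⟫_ℝ := by
  rw [inner_hess hΩ hf hx, real_inner_comm, inner_hess hΩ hf hx]
  exact (hf.contDiffAt (hΩ.mem_nhds hx)).isSymmSndFDerivAt (by simp) u v

theorem add_smul_mem_of_segment {x v : E n} (hseg : segment ℝ x (x + v) ⊆ Ω) {t : ℝ}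
    (ht : t ∈ Set.Icc (0 : ℝ) 1) : x + t • v ∈ Ω := by
  apply hseg
  rw [segment_eq_image']
  exact ⟨t, ht, by simp⟩

/-- Comparison of derivatives along the segment: at parameter s the remainder has derivative at most
L_H s‖v‖². Integrating once more gives `function_taylor`. -/
theorem gradient_taylor (hΩ : IsOpen Ω) (hf : ContDiffOn ℝ 2 f Ω)
    (hL : ∀ x ∈ Ω, ∀ y ∈ Ω, ‖hess f x - hess f y‖ ≤ LH * ‖x - y‖) {x v : E n}
    (hseg : segment ℝ x (x + v) ⊆ Ω) {t : ℝ} (ht : t ∈ Set.Icc (0 : ℝ) 1) :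
    ‖∇ f (x + t • v) - ∇ f x - t • hess f x v‖ ≤ LH / 2 * t ^ 2 * ‖v‖ ^ 2 := by
  have hx : x ∈ Ω := hseg (left_mem_segment ℝ _ _)
  have hline : ∀ s : ℝ, HasDerivAt (fun s : ℝ => x + s • v) v s := fun s => by
    simpa using ((hasDerivAt_id s).smul_const v).const_add x
  have hder : ∀ s ∈ Set.Icc (0 : ℝ) 1,
      HasDerivAt (fun s : ℝ => ∇ f (x + s • v) - ∇ f x - s • hess f x v)
        (hess f (x + s • v) v - hess f x v) s := by
    intro s hs
    have h1 := (hasFDerivAt_gradient hΩ hf (add_smul_mem_of_segment hseg hs)).comp_hasDerivAt s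
      (hline s)
    exact ((h1.sub_const (∇ f x)).sub ((hasDerivAt_id s).smul_const (hess f x v))).congr_deriv
      (by rw [one_smul])
  refine image_norm_le_of_norm_deriv_right_le_deriv_boundary (a := 0) (b := 1)
    (B := fun t => LH / 2 * t ^ 2 * ‖v‖ ^ 2) (B' := fun t => LH * t * ‖v‖ ^ 2)
    (fun s hs => (hder s hs).continuousAt.continuousWithinAt)
    (fun s hs => (hder s ⟨hs.1, hs.2.le⟩).hasDerivWithinAt) (by simp) (fun s => ?_) ?_ ht
  · exact (((hasDerivAt_pow 2 s).const_mul (LH / 2)).mul_const (‖v‖ ^ 2)).congr_deriv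
      (by push_cast; ring)
  · intro s hs
    have h1 := hL _ (add_smul_mem_of_segment hseg ⟨hs.1, hs.2.le⟩) x hx
    rw [add_sub_cancel_left, norm_smul, Real.norm_eq_abs, abs_of_nonneg hs.1] at h1
    rw [← sub_apply]
    refine (ContinuousLinearMap.le_opNorm _ _).trans ?_
    refine (mul_le_mul_of_nonneg_right h1 (norm_nonneg v)).trans (le_of_eq (by ring))

theorem function_taylor (hΩ : IsOpen Ω) (hf : ContDiffOn ℝ 2 f Ω)
    (hL : ∀ x ∈ Ω, ∀ y ∈ Ω, ‖hess f x - hess f y‖ ≤ LH * ‖x - y‖) {x v : E n}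
    (hseg : segment ℝ x (x + v) ⊆ Ω) {t : ℝ} (ht : t ∈ Set.Icc (0 : ℝ) 1) :
    f (x + t • v) ≤ f x + t * ⟪∇ f x, v⟫_ℝ + t ^ 2 / 2 * ⟪v, hess f x v⟫_ℝ +
      LH / 6 * t ^ 3 * ‖v‖ ^ 3 := by
  have hline : ∀ s : ℝ, HasDerivAt (fun s : ℝ => x + s • v) v s := fun s => by
    simpa using ((hasDerivAt_id s).smul_const v).const_add x
  have hder : ∀ s ∈ Set.Icc (0 : ℝ) 1,
      HasDerivAt (fun s : ℝ => f (x + s • v) - f x - s * ⟪∇ f x, v⟫_ℝ -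
        s ^ 2 / 2 * ⟪v, hess f x v⟫_ℝ)
        ⟪∇ f (x + s • v) - ∇ f x - s • hess f x v, v⟫_ℝ s := by
    intro s hs
    have h1 := (hasGradientAt_of_contDiffOn hΩ hf
      (add_smul_mem_of_segment hseg hs)).hasFDerivAt.comp_hasDerivAt s (hline s)
    have h2 := ((h1.sub_const (f x)).sub ((hasDerivAt_id s).mul_const ⟪∇ f x, v⟫_ℝ)).sub
      (((hasDerivAt_pow 2 s).div_const 2).mul_const ⟪v, hess f x v⟫_ℝ)
    refine h2.congr_deriv ?_
    rw [InnerProductSpace.toDual_apply_apply, inner_sub_left, inner_sub_left, inner_smul_left,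
      conj_trivial, real_inner_comm v (hess f x v)]
    push_cast
    ring
  have key := image_norm_le_of_norm_deriv_right_le_deriv_boundary (a := 0) (b := 1)
    (B := fun t => LH / 6 * t ^ 3 * ‖v‖ ^ 3) (B' := fun t => LH / 2 * t ^ 2 * ‖v‖ ^ 3)
    (fun s hs => (hder s hs).continuousAt.continuousWithinAt)
    (fun s hs => (hder s ⟨hs.1, hs.2.le⟩).hasDerivWithinAt) (by simp) (fun s => by
      exact (((hasDerivAt_pow 3 s).const_mul (LH / 6)).mul_const (‖v‖ ^ 3)).congr_deriv
        (by push_cast; ring)) (fun s hs => by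
      have h1 := gradient_taylor hΩ hf hL hseg ⟨hs.1, hs.2.le⟩
      refine (norm_inner_le_norm _ _).trans ?_
      refine (mul_le_mul_of_nonneg_right h1 (norm_nonneg v)).trans (le_of_eq (by ring))) ht
  have := (abs_le.1 key).2
  linarith

end Taylor

/-! ### The barrier function along scaled directions -/

/-- Two terms of the logarithmic series, with the geometric bound for the tail. -/
theorem neg_log_one_add_le {β t : ℝ} (hβ : β < 1) (ht : |t| ≤ β) :
    -Real.log (1 + t) ≤ -t + t ^ 2 / 2 + |t| ^ 3 / (1 - β) := by
  have h := Real.abs_log_sub_add_sum_range_le (x := -t) (by rw [abs_neg]; linarith) 2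
  rw [abs_neg, Finset.sum_range_succ, Finset.sum_range_one] at h
  have h2 : |t| ^ 3 / (1 - |t|) ≤ |t| ^ 3 / (1 - β) := by
    have : 0 < 1 - β := by linarith
    gcongr
  have h3 := (abs_le.1 h).1
  norm_num at h3
  linarith

section Barrier

variable {n : ℕ}

theorem barX_apply (x v : E n) (i : Fin n) : barX x v i = min (x i) 1 * v i := diagOp_apply _ _ _

theorem invX_apply (x v : E n) (i : Fin n) : invX x v i = (x i)⁻¹ * v i := diagOp_apply _ _ _

/-- The relative change `X⁻¹X̄d` of the coordinates in the step from `x` to `x + X̄d`. -/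
def relStep (x d : E n) : E n := invX x (barX x d)

theorem relStep_apply (x d : E n) (i : Fin n) :
    relStep x d i = (x i)⁻¹ * (min (x i) 1 * d i) := by
  rw [relStep, invX_apply, barX_apply]

theorem relStep_smul (x d : E n) (c : ℝ) : relStep x (c • d) = c • relStep x d := by
  simp [relStep]

variable {x : E n}

theorem ratio_mem (hx : ∀ i, 0 < x i) (i : Fin n) :
    0 < (x i)⁻¹ * min (x i) 1 ∧ (x i)⁻¹ * min (x i) 1 ≤ 1 := by
  have h := hx i
  refine ⟨mul_pos (inv_pos.2 h) (lt_min h one_pos), ?_⟩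
  rw [inv_mul_le_one₀ h]
  exact min_le_left _ _

theorem abs_relStep_le (hx : ∀ i, 0 < x i) (d : E n) (i : Fin n) : |relStep x d i| ≤ |d i| := by
  obtain ⟨h1, h2⟩ := ratio_mem hx i
  rw [relStep_apply, ← mul_assoc, abs_mul, abs_of_pos h1]
  exact mul_le_of_le_one_left (abs_nonneg _) h2

theorem abs_barX_le (hx : ∀ i, 0 < x i) (d : E n) (i : Fin n) : |barX x d i| ≤ |d i| := by
  have h : 0 < min (x i) 1 := lt_min (hx i) one_pos
  rw [barX_apply, abs_mul, abs_of_pos h]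
  exact mul_le_of_le_one_left (abs_nonneg _) (min_le_right _ _)

theorem norm_le_norm_of_abs_le {u v : E n} (h : ∀ i, |u i| ≤ |v i|) : ‖u‖ ≤ ‖v‖ := by
  rw [EuclideanSpace.norm_eq, EuclideanSpace.norm_eq]
  refine Real.sqrt_le_sqrt (Finset.sum_le_sum fun i _ => ?_)
  simp only [Real.norm_eq_abs]
  exact pow_le_pow_left₀ (abs_nonneg _) (h i) 2

theorem norm_barX_le (hx : ∀ i, 0 < x i) (d : E n) : ‖barX x d‖ ≤ ‖d‖ :=
  norm_le_norm_of_abs_le (abs_barX_le hx d)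

theorem supNorm_relStep_le (hx : ∀ i, 0 < x i) (d : E n) : supNorm (relStep x d) ≤ ‖d‖ :=
  supNorm_le (norm_nonneg _) fun i => (abs_relStep_le hx d i).trans (abs_apply_le_norm d i)

theorem supNorm_relStep_pos (hx : ∀ i, 0 < x i) {d : E n} (hd : d ≠ 0) :
    0 < supNorm (relStep x d) := by
  obtain ⟨i, hi⟩ : ∃ i, d i ≠ 0 := by
    by_contra! h
    exact hd (PiLp.ext h)
  refine lt_of_lt_of_le ?_ (abs_apply_le_supNorm _ i)
  rw [relStep_apply, ← mul_assoc]
  exact abs_pos.2 (mul_ne_zero (ratio_mem hx i).1.ne' hi)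

theorem sum_abs_relStep_cube_le (hx : ∀ i, 0 < x i) (d : E n) :
    ∑ i, |relStep x d i| ^ 3 ≤ ‖d‖ ^ 3 := by
  have h : ‖d‖ ^ 3 = ∑ i, ‖d‖ * |d i| ^ 2 := by
    rw [← Finset.mul_sum]
    have := EuclideanSpace.norm_sq_eq d
    simp only [Real.norm_eq_abs] at this
    rw [← this]
    ring
  rw [h]
  refine Finset.sum_le_sum fun i _ => ?_
  refine (pow_le_pow_left₀ (abs_nonneg _) (abs_relStep_le hx d i) 3).trans ?_
  rw [pow_succ']
  exact mul_le_mul_of_nonneg_right (abs_apply_le_norm d i) (by positivity)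

theorem add_smul_barX_apply (hx : ∀ i, 0 < x i) (d : E n) (t : ℝ) (i : Fin n) :
    (x + t • barX x d) i = x i * (1 + t * relStep x d i) := by
  have h := (hx i).ne'
  simp only [PiLp.add_apply, PiLp.smul_apply, smul_eq_mul, barX_apply, relStep_apply]
  field_simp

theorem one_add_relStep_pos {β : ℝ} (hβ1 : β < 1) {d : E n}
    (hd : supNorm (relStep x d) ≤ β) {t : ℝ} (ht : t ∈ Set.Icc (0 : ℝ) 1) (i : Fin n) :
    |t * relStep x d i| ≤ β ∧ 0 < 1 + t * relStep x d i := by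
  have h1 : |t * relStep x d i| ≤ β := by
    rw [abs_mul, abs_of_nonneg ht.1]
    exact (mul_le_of_le_one_left (abs_nonneg _) ht.2).trans ((abs_apply_le_supNorm _ i).trans hd)
  exact ⟨h1, by linarith [(abs_le.1 h1).1]⟩

theorem step_pos (hx : ∀ i, 0 < x i) {β : ℝ} (hβ1 : β < 1) {d : E n}
    (hd : supNorm (relStep x d) ≤ β) {t : ℝ} (ht : t ∈ Set.Icc (0 : ℝ) 1) (i : Fin n) :
    0 < (x + t • barX x d) i := by
  rw [add_smul_barX_apply hx]
  exact mul_pos (hx i) (one_add_relStep_pos hβ1 hd ht i).2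

theorem inner_scaledGrad (f : E n → ℝ) (μ : ℝ) (x d : E n) :
    ⟪scaledGrad f μ x, d⟫_ℝ = ⟪∇ f x, barX x d⟫_ℝ - μ * ∑ i, relStep x d i := by
  rw [scaledGrad, barX, inner_diagOp_left, ← barX, gradPhi, inner_sub_left, inner_smul_left,
    inner_eq_sum (WithLp.toLp 2 fun i => (x i)⁻¹)]
  simp only [conj_trivial, barX_apply, relStep_apply]

theorem inner_scaledHess (f : E n → ℝ) (μ : ℝ) (x d : E n) :
    ⟪d, scaledHess f μ x d⟫_ℝ =
      ⟪barX x d, hess f x (barX x d)⟫_ℝ + μ * ∑ i, relStep x d i ^ 2 := by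
  rw [scaledHess, ContinuousLinearMap.comp_apply, barX, ← inner_diagOp_left, ← barX, hessPhi,
    ContinuousLinearMap.comp_apply, add_apply, inner_add_right,
    smul_apply, inner_smul_right, ContinuousLinearMap.comp_apply, invX,
    ← inner_diagOp_left, ← invX, ← relStep, inner_eq_sum (relStep x d)]
  simp only [pow_two]

theorem scaledHess_symm {f : E n → ℝ} {Ω : Set (E n)} (hΩ : IsOpen Ω) (hf : ContDiffOn ℝ 2 f Ω)
    (μ : ℝ) (hx : x ∈ Ω) (u v : E n) :
    ⟪scaledHess f μ x u, v⟫_ℝ = ⟪u, scaledHess f μ x v⟫_ℝ := by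
  have key : ∀ a b, ⟪hessPhi f μ x a, b⟫_ℝ = ⟪a, hessPhi f μ x b⟫_ℝ := by
    intro a b
    rw [hessPhi, add_apply, add_apply, inner_add_left, inner_add_right,
      inner_hess_comm hΩ hf hx, smul_apply, smul_apply, inner_smul_left, inner_smul_right,
      ContinuousLinearMap.comp_apply, ContinuousLinearMap.comp_apply, invX, inner_diagOp_left,
      inner_diagOp_left]
    rfl
  simp only [scaledHess, ContinuousLinearMap.comp_apply, barX]
  rw [inner_diagOp_left, key, inner_diagOp_left]

/-- The coefficient of the cubic term in the expansion of the barrier function. -/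
def cubicCoeff (LH β : ℝ) : ℝ := LH + (2 - β) / (1 - β) ^ 2

/-- The Taylor bound for f along X̄d is added to the logarithmic bound in each coordinate. The
relative steps are at most |d_i|, so their cubes sum to at most ‖d‖³. -/
theorem phi_taylor {f : E n → ℝ} {Ω : Set (E n)} {LH β μ : ℝ} (hLH : 0 ≤ LH) (hΩ : IsOpen Ω)
    (hf : ContDiffOn ℝ 2 f Ω)
    (hL : ∀ x ∈ Ω, ∀ y ∈ Ω, ‖hess f x - hess f y‖ ≤ LH * ‖x - y‖)
    (hx : ∀ i, 0 < x i) {d : E n} (hseg : segment ℝ x (x + barX x d) ⊆ Ω) (hβ0 : 0 ≤ β)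
    (hβ1 : β < 1) (hd : supNorm (relStep x d) ≤ β) (hμ0 : 0 ≤ μ) (hμ : μ ≤ 1 / 4) {t : ℝ}
    (ht : t ∈ Set.Icc (0 : ℝ) 1) :
    phi f μ (x + t • barX x d) ≤ phi f μ x + t * ⟪scaledGrad f μ x, d⟫_ℝ +
      t ^ 2 / 2 * ⟪d, scaledHess f μ x d⟫_ℝ + cubicCoeff LH β / 6 * t ^ 3 * ‖d‖ ^ 3 := by
  have h1 := function_taylor hΩ hf hL hseg ht
  have hlog : ∀ i, -Real.log ((x + t • barX x d) i) ≤ -Real.log (x i) - t * relStep x d i +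
      t ^ 2 / 2 * relStep x d i ^ 2 + t ^ 3 / (1 - β) * |relStep x d i| ^ 3 := by
    intro i
    obtain ⟨h2, h3⟩ := one_add_relStep_pos hβ1 hd ht i
    rw [add_smul_barX_apply hx, Real.log_mul (hx i).ne' h3.ne']
    have h4 := neg_log_one_add_le hβ1 h2
    rw [abs_mul, abs_of_nonneg ht.1] at h4
    have e : (t * |relStep x d i|) ^ 3 / (1 - β) = t ^ 3 / (1 - β) * |relStep x d i| ^ 3 := by
      ring
    rw [e] at h4
    linarith
  have hsum := Finset.sum_le_sum fun i (_ : i ∈ Finset.univ) => hlog i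
  simp only [Finset.sum_add_distrib, Finset.sum_sub_distrib, Finset.sum_neg_distrib,
    ← Finset.mul_sum] at hsum
  have hb : 0 < 1 - β := by linarith
  have hcube : t ^ 3 / (1 - β) * ∑ i, |relStep x d i| ^ 3 ≤ t ^ 3 / (1 - β) * ‖d‖ ^ 3 :=
    mul_le_mul_of_nonneg_left (sum_abs_relStep_cube_le hx d)
      (div_nonneg (pow_nonneg ht.1 3) hb.le)
  have hsum2 := mul_le_mul_of_nonneg_left (hsum.trans (add_le_add_right hcube _)) hμ0
  -- Here μ ≤ 1/4 enters: 6μ(1 - β) ≤ (3/2)(1 - β) ≤ 2 - β.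
  have hcoef : μ / (1 - β) ≤ (2 - β) / (1 - β) ^ 2 / 6 := by
    rw [div_div, div_le_div_iff₀ hb (by positivity)]
    have : μ * (1 - β) * 6 ≤ 1 / 4 * (1 - β) * 6 := by gcongr
    nlinarith
  have hcoef2 := mul_le_mul_of_nonneg_right hcoef
    (by have := ht.1; positivity : 0 ≤ t ^ 3 * ‖d‖ ^ 3)
  have hnorm : LH / 6 * t ^ 3 * ‖barX x d‖ ^ 3 ≤ LH / 6 * t ^ 3 * ‖d‖ ^ 3 := by
    have := ht.1
    have := norm_barX_le hx d
    gcongr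
  rw [inner_scaledGrad, inner_scaledHess, phi, phi, cubicCoeff]
  have e : μ * (t ^ 3 / (1 - β) * ‖d‖ ^ 3) = μ / (1 - β) * (t ^ 3 * ‖d‖ ^ 3) := by ring
  rw [mul_add, e] at hsum2
  linarith

end Barrier

/-! ### Constants -/

section Constants

variable (P : Params) {LH : ℝ}

theorem cubicCoeff_pos (hLH : 0 < LH) : 0 < cubicCoeff LH P.β := by
  have h := P.β_mem.2
  have h1 : 0 < 2 - P.β := by linarith
  have h2 : 0 < 1 - P.β := by linarith
  unfold cubicCoeff
  positivity

/-- The denominator D is (1 - β)² times cubic coefficient plus η, the form in which the line search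
produces it. -/
theorem cNc_eq (hLH : 0 < LH) :
    cNc P LH = min 1 (3 * P.θ / (cubicCoeff LH P.β + P.η)) := by
  have h := cubicCoeff_pos P hLH
  have hη := P.η_mem.1
  have h2 : 0 < 1 - P.β := by linarith [P.β_mem.2]
  have e : (LH + P.η) * (1 - P.β) ^ 2 + (2 - P.β) =
      (cubicCoeff LH P.β + P.η) * (1 - P.β) ^ 2 := by
    unfold cubicCoeff
    field_simp
    ring
  rw [cNc, e]
  congr 1
  field_simp

theorem cSol_eq (hLH : 0 < LH) :
    cSol P LH = min (cD P LH) (6 * P.θ ^ 2 / (cubicCoeff LH P.β + P.η)) := by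
  have h := cubicCoeff_pos P hLH
  have hη := P.η_mem.1
  have h2 : 0 < 1 - P.β := by linarith [P.β_mem.2]
  have e : (LH + P.η) * (1 - P.β) ^ 2 + (2 - P.β) =
      (cubicCoeff LH P.β + P.η) * (1 - P.β) ^ 2 := by
    unfold cubicCoeff
    field_simp
    ring
  rw [cSol, e]
  congr 1
  field_simp

theorem cD_pos (hLH : 0 < LH) : 0 < cD P LH := by
  have h1 := P.ζbar_mem.2
  have h2 := P.ζr_mem.1
  refine lt_min (by linarith) (lt_min (Real.sqrt_pos.2 (by positivity)) (by positivity))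

theorem cAll_pos (hLH : 0 < LH) : 0 < cAll P LH := by
  have h := cubicCoeff_pos P hLH
  have hη := P.η_mem.1
  have hθ := P.θ_mem.1
  rw [cAll, cSol_eq P hLH, cNc_eq P hLH]
  exact lt_min (lt_min (cD_pos P hLH) (by positivity)) (lt_min one_pos (by positivity))

end Constants

/-! ### The line search -/

theorem sgn_mul_self (t : ℝ) : sgn t * t = |t| := by
  unfold sgn
  split_ifs with h
  · rw [abs_of_neg h]; ring
  · rw [abs_of_nonneg (not_lt.1 h)]; ring

theorem abs_sgn (t : ℝ) : |sgn t| = 1 := by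
  unfold sgn
  split_ifs <;> simp

namespace Input

variable {P : Params} {n : ℕ} (A : Input P n)

/-- If backtracking occurred, the previous trial θ^{j-1} was rejected and hence is at least the
threshold b. -/
theorem exists_lineSearch {x d : E n} {b : ℝ} (hb : 0 < b)
    (h : ∀ t ∈ Set.Ioc (0 : ℝ) 1, t < b →
      phi A.f A.μ (x + t • barX x d) < phi A.f A.μ x - P.η / 6 * t ^ 3 * ‖d‖ ^ 3) :
    ∃ t ∈ Set.Ioc (0 : ℝ) 1, A.lineSearch x d = some (x + t • barX x d) ∧
      phi A.f A.μ (x + t • barX x d) < phi A.f A.μ x - P.η / 6 * t ^ 3 * ‖d‖ ^ 3 ∧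
      (t = 1 ∨ P.θ * b ≤ t) := by
  classical
  obtain ⟨hθ0, hθ1⟩ := P.θ_mem
  have hmem : ∀ j : ℕ, P.θ ^ j ∈ Set.Ioc (0 : ℝ) 1 :=
    fun j => ⟨pow_pos hθ0 j, pow_le_one₀ hθ0.le hθ1.le⟩
  have hex : ∃ j, A.Decrease x d j := by
    obtain ⟨j, hj⟩ := exists_pow_lt_of_lt_one hb hθ1
    exact ⟨j, h _ (hmem j) hj⟩
  refine ⟨P.θ ^ Nat.find hex, hmem _, by rw [lineSearch, dif_pos hex], Nat.find_spec hex, ?_⟩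
  rcases Nat.eq_zero_or_pos (Nat.find hex) with h0 | hpos
  · left; rw [h0, pow_zero]
  · right
    obtain ⟨j, hj⟩ := Nat.exists_eq_succ_of_ne_zero hpos.ne'
    have hfail := Nat.find_min hex (m := j) (by omega)
    have hge : b ≤ P.θ ^ j := by
      by_contra hlt
      exact hfail (h _ (hmem j) (not_le.1 hlt))
    rw [hj, Nat.succ_eq_add_one, pow_succ']
    exact mul_le_mul_of_nonneg_left hge hθ0.le

theorem εH_pos : 0 < A.εH := Real.sqrt_pos.2 A.εg_mem.1

theorem εH_sq : A.εH ^ 2 = A.εg := Real.sq_sqrt A.εg_mem.1.le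

theorem εH_lt_one : A.εH < 1 := A.sqrt_le_β.trans_lt P.β_mem.2

theorem μ_pos : 0 < A.μ := div_pos A.εg_mem.1 (by norm_num)

theorem μ_le : A.μ ≤ 1 / 4 := by
  have := A.εg_mem.2
  unfold μ
  linarith

theorem cμ_pos : 0 < A.cμ := mul_pos P.ζbar_mem.1 A.μ_pos

end Input

/-! ### Negative curvature directions -/

/-- A step along a direction of negative curvature: `d = -sgn(gᵀv) min(|vᵀHv|/‖v‖³, β/…) v`. -/
theorem nc_scaling {n : ℕ} {H : E n →L[ℝ] E n} {g x v : E n} {ε β : ℝ} (hε : 0 < ε)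
    (hεβ : ε ≤ β) (hx : ∀ i, 0 < x i) (hv : CG.LowCurv ε (H v) v) {σ : ℝ}
    (hσ1 : |σ| = 1) (hσ : σ * ⟪g, v⟫_ℝ = |⟪g, v⟫_ℝ|) {d : E n}
    (hd : d = (-σ * min (|⟪v, H v⟫_ℝ| / ‖v‖ ^ 3) (β / supNorm (relStep x v))) • v) :
    supNorm (relStep x d) ≤ β ∧ ε ≤ ‖d‖ ∧ ⟪g, d⟫_ℝ ≤ 0 ∧ ⟪d, H d⟫_ℝ ≤ -‖d‖ ^ 3 := by
  have hv0 : v ≠ 0 := by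
    rintro rfl
    simp [CG.LowCurv] at hv
  have hq : ⟪v, H v⟫_ℝ < -ε * ‖v‖ ^ 2 := by
    rw [CG.LowCurv, inner_add_right, inner_smul_right, real_inner_self_eq_norm_sq] at hv
    linarith
  have hvn := norm_pos_iff.2 hv0
  have hS := supNorm_relStep_pos hx hv0
  have hSv := supNorm_relStep_le hx v
  set S := supNorm (relStep x v)
  set q := ⟪v, H v⟫_ℝ
  set N := ‖v‖
  have hq0 : q < 0 := hq.trans (by have : 0 < ε * N ^ 2 := by positivity
                                   linarith)
  set m := min (|q| / N ^ 3) (β / S) with hm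
  have hm0 : 0 < m := lt_min (div_pos (abs_pos.2 hq0.ne) (by positivity))
    (div_pos (hε.trans_le hεβ) hS)
  have habs : |-σ * m| = m := by rw [abs_mul, abs_neg, hσ1, one_mul, abs_of_pos hm0]
  have hdn : ‖d‖ = m * N := by rw [hd, norm_smul, Real.norm_eq_abs, habs]
  have hm1 : m * N ^ 3 ≤ -q := by
    have := min_le_left (|q| / N ^ 3) (β / S)
    rw [← hm, le_div_iff₀ (by positivity), abs_of_neg hq0] at this
    exact this
  refine ⟨?_, ?_, ?_, ?_⟩
  · rw [hd, relStep_smul, supNorm_smul, habs]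
    have := min_le_right (|q| / N ^ 3) (β / S)
    rw [← hm, le_div_iff₀ hS] at this
    exact this
  · rw [hdn, hm]
    -- In the first case ‖d‖ = |q|/‖v‖² > ε by low curvature; in the second, ‖d‖ = β‖v‖/S ≥ β ≥ ε,
    -- as relative steps never exceed ‖v‖.
    rcases min_choice (|q| / N ^ 3) (β / S) with h | h
    · rw [h, abs_of_neg hq0, div_mul_eq_mul_div, le_div_iff₀ (by positivity)]
      nlinarith
    · rw [h, div_mul_eq_mul_div, le_div_iff₀ hS]
      have := hε.trans_le hεβ
      nlinarith
  · rw [hd, inner_smul_right]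
    have : -σ * m * ⟪g, v⟫_ℝ = -(m * |⟪g, v⟫_ℝ|) := by rw [← hσ]; ring
    rw [this]
    have := mul_nonneg hm0.le (abs_nonneg ⟪g, v⟫_ℝ)
    linarith
  · have hsq : (-σ * m) * (-σ * m) = m ^ 2 := by
      rw [← abs_mul_abs_self, habs]; ring
    rw [hdn, hd, map_smul, inner_smul_left, inner_smul_right, conj_trivial, ← mul_assoc, hsq]
    have : m ^ 2 * (m * N ^ 3) ≤ m ^ 2 * (-q) := mul_le_mul_of_nonneg_left hm1 (sq_nonneg m)
    nlinarith

/-- The decrease of a cubic model along a direction of negative curvature. -/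
theorem nc_decrease {φ G Q C η N t : ℝ} (hη : 0 < η) (hC : 0 < C) (hN : 0 < N) (hG : G ≤ 0)
    (hQ : Q ≤ -N ^ 3) (ht : 0 < t) (htb : t < 3 / (C + η)) :
    φ + t * G + t ^ 2 / 2 * Q + C / 6 * t ^ 3 * N ^ 3 < φ - η / 6 * t ^ 3 * N ^ 3 := by
  rw [lt_div_iff₀ (by positivity)] at htb
  have h1 := mul_nonpos_of_nonneg_of_nonpos ht.le hG
  have h2 := mul_le_mul_of_nonneg_left hQ (by positivity : 0 ≤ t ^ 2 / 2)
  have h3 := mul_lt_mul_of_pos_left htb (by positivity : 0 < t ^ 2 * N ^ 3)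
  nlinarith

/-! ### Approximate Newton directions -/

/-- A direction cut back by the β-rule has norm at least β, so a shorter one is the unscaled v. For
the decrease put a = tm, with m the scaling factor. As ⟨g, v⟩ = -⟨v, H̄v⟩, the quadratic model is
-(a - a²/2)⟨v, H̄v⟩ - a²ε‖v‖², and ⟨v, H̄v⟩ ≥ ε‖v‖². -/
theorem sol_scaling {n : ℕ} {H : E n →L[ℝ] E n} {g x v : E n} {ε β : ℝ} (hε : 0 < ε)
    (hβ : 0 < β) (hx : ∀ i, 0 < x i) (hv0 : v ≠ 0) (hv : ¬ CG.LowCurv ε (H v) v)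
    (hg : ⟪g, v⟫_ℝ = -⟪v, CG.shift H ε v⟫_ℝ) {d : E n}
    (hd : d = min 1 (β / supNorm (relStep x v)) • v) :
    supNorm (relStep x d) ≤ β ∧ d ≠ 0 ∧ (‖d‖ < β → d = v) ∧
      ∀ t ∈ Set.Ioc (0 : ℝ) 1,
        t * ⟪g, d⟫_ℝ + t ^ 2 / 2 * ⟪d, H d⟫_ℝ ≤ -(t * ε * ‖d‖ ^ 2) := by
  have hS := supNorm_relStep_pos hx hv0
  have hSv := supNorm_relStep_le hx v
  set S := supNorm (relStep x v)
  set m := min 1 (β / S) with hm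
  have hm0 : 0 < m := lt_min one_pos (div_pos hβ hS)
  have hm1 : m ≤ 1 := min_le_left _ _
  have hdn : ‖d‖ = m * ‖v‖ := by rw [hd, norm_smul, Real.norm_eq_abs, abs_of_pos hm0]
  refine ⟨?_, ?_, ?_, ?_⟩
  · rw [hd, relStep_smul, supNorm_smul, abs_of_pos hm0]
    have := min_le_right 1 (β / S)
    rw [← hm, le_div_iff₀ hS] at this
    exact this
  · rw [hd]
    exact smul_ne_zero hm0.ne' hv0
  · intro hlt
    rcases min_choice 1 (β / S) with h | h
    · rw [hd, hm, h, one_smul]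
    · exfalso
      rw [hdn, hm, h, div_mul_eq_mul_div, div_lt_iff₀ hS] at hlt
      nlinarith
  · intro t ht
    have hq : ε * ‖v‖ ^ 2 ≤ ⟪v, CG.shift H ε v⟫_ℝ := not_lt.1 hv
    have hH : ⟪v, H v⟫_ℝ = ⟪v, CG.shift H ε v⟫_ℝ - 2 * ε * ‖v‖ ^ 2 := by
      rw [CG.shift, inner_add_right, inner_smul_right, real_inner_self_eq_norm_sq]
      ring
    rw [hdn, hd, map_smul, inner_smul_left, inner_smul_right, inner_smul_right, conj_trivial,
      hg, hH]
    generalize ⟪v, CG.shift H ε v⟫_ℝ = q at *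
    have ha0 : 0 < t * m := mul_pos ht.1 hm0
    have ha1 : t * m ≤ 1 := mul_le_one₀ ht.2 hm0.le hm1
    have h1 : 0 ≤ (t * m - (t * m) ^ 2 / 2) * (q - ε * ‖v‖ ^ 2) := by
      refine mul_nonneg ?_ (by linarith)
      nlinarith
    have h2 : 0 ≤ (t * m) ^ 2 * (ε * ‖v‖ ^ 2) := by positivity
    have h3 : t * m * m * (ε * ‖v‖ ^ 2) ≤ t * m * (ε * ‖v‖ ^ 2) := by
      have := mul_le_mul_of_nonneg_left hm1 ha0.le
      rw [mul_one] at this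
      exact mul_le_mul_of_nonneg_right this (by positivity)
    nlinarith

theorem sol_decrease {φ G Q C η N t ε : ℝ} (hη : 0 < η) (hC : 0 < C) (hN : 0 < N)
    (ht : 0 < t) (ht1 : t ≤ 1) (hGQ : t * G + t ^ 2 / 2 * Q ≤ -(t * ε * N ^ 2))
    (htb : t < 6 * ε / ((C + η) * N)) :
    φ + t * G + t ^ 2 / 2 * Q + C / 6 * t ^ 3 * N ^ 3 < φ - η / 6 * t ^ 3 * N ^ 3 := by
  rw [lt_div_iff₀ (by positivity)] at htb
  -- The cubic term only calls for a bound on t²; t ≤ 1 lets a bound on t suffice.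
  have h1 : t * (t * ((C + η) * N)) ≤ t * ((C + η) * N) :=
    mul_le_of_le_one_left (by positivity) ht1
  have h2 := mul_lt_mul_of_pos_left (h1.trans_lt htb) (by positivity : 0 < t * N ^ 2)
  nlinarith

/-! ### Full Newton steps that are short lead to first-order points -/

/-- The bounds on one coordinate after a short Newton step. Here `a = min(xᵢ, 1)`, `b = a/xᵢ`. -/
theorem coordinate_bounds {LH ζbar ζr c εg ε μ δ a b t e r di G : ℝ}
    (hLH : 0 < LH) (hζ0 : 0 < ζbar) (hζ1 : ζbar < 1) (hζr : 0 < ζr)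
    (hεg : 0 < εg) (hε0 : 0 < ε) (hε : ε ^ 2 = εg) (hε1 : ε < 1) (hμ : μ = εg / 4)
    (hc0 : 0 < c) (hc1 : c ≤ (1 - ζbar) / 9) (hc2 : c ≤ √(3 / (2 * LH)))
    (hc3 : c ≤ 1 / (2 * (LH + 9 / 2 + ζr))) (hδ0 : 0 ≤ δ) (hδ : δ ≤ c * ε)
    (ha0 : 0 < a) (ha1 : a ≤ 1) (hb0 : 0 < b) (hb1 : b ≤ 1) (hab : b = 1 ∨ a = 1)
    (ht : |t| ≤ δ) (he : |e| ≤ LH / 2 * δ ^ 2) (hr : |r| ≤ ζbar * μ) (hdi : |di| ≤ δ)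
    (hG : a * G = a * e + r + μ * b * (1 - t) - 2 * ε * di) :
    -εg ≤ G ∧ (1 + δ) * |a * G| ≤ εg := by
  have hcsq : LH * c ^ 2 ≤ 3 / 2 := by
    have := pow_le_pow_left₀ hc0.le hc2 2
    rw [Real.sq_sqrt (by positivity), le_div_iff₀ (by positivity)] at this
    linarith
  have hc4 : c * (LH + 9 / 2) ≤ 1 / 2 := by
    rw [le_div_iff₀ (by positivity)] at hc3
    nlinarith
  have hc9 : c ≤ 1 / 9 := by linarith
  have hεδ : ε * δ ≤ c * εg := by
    have := mul_le_mul_of_nonneg_left hδ hε0.le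
    rw [← hε]; linarith
  have hδc : δ ≤ c := hδ.trans (mul_le_of_le_one_right hc0.le hε1.le)
  have hδsq : δ ^ 2 ≤ c ^ 2 * εg := by
    rw [← hε, ← mul_pow]; exact pow_le_pow_left₀ hδ0 hδ 2
  have heb : LH / 2 * δ ^ 2 ≤ LH / 2 * (c ^ 2 * εg) :=
    mul_le_mul_of_nonneg_left hδsq (by positivity)
  have hμ0 : 0 < μ := by rw [hμ]; positivity
  obtain ⟨ht1, ht2⟩ := abs_le.1 ht
  obtain ⟨he1, he2⟩ := abs_le.1 (he.trans heb)
  obtain ⟨hr1, hr2⟩ := abs_le.1 hr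
  obtain ⟨hd1, hd2⟩ := abs_le.1 hdi
  have hdi1 : 2 * ε * di ≤ 2 * (c * εg) := by
    linarith [mul_le_mul_of_nonneg_left hd2 hε0.le]
  have hdi2 : -(2 * (c * εg)) ≤ 2 * ε * di := by
    linarith [mul_le_mul_of_nonneg_left hd1 hε0.le]
  -- The first entry of c_d: of the margin (1 - ζ̄)μ left by the residual, 8/9 pays for 2εd_i, and
  -- 1/9 is kept for the relative step t.
  have hcε : 2 * (c * εg) ≤ 8 / 9 * (1 - ζbar) * μ := by
    rw [hμ]; linarith [mul_le_mul_of_nonneg_right hc1 hεg.le]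
  have he34 : LH / 2 * (c ^ 2 * εg) ≤ 3 / 4 * εg := by
    linarith [mul_le_mul_of_nonneg_right hcsq hεg.le]
  constructor
  · rcases hab with rfl | rfl
    -- With b = 1 the factor a may be tiny, so all terms without a must cancel: (1 - (1 - ζ̄)/9) -
    -- ζ̄ - (8/9)(1 - ζ̄) = 0. Only the Taylor error, which carries a, remains.
    · have hsum : -(a * εg) ≤ a * G := by
        have h1 : -(a * εg) ≤ a * e := by
          linarith [mul_le_mul_of_nonneg_left (by linarith : -εg ≤ e) ha0.le]
        have h2 : μ * (1 - t) ≥ μ * (1 - (1 - ζbar) / 9) := by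
          refine mul_le_mul_of_nonneg_left ?_ hμ0.le
          linarith
        rw [hG]
        linarith
      exact le_of_mul_le_mul_left (by linarith : a * (-εg) ≤ a * G) ha0
    · have h2 : 0 ≤ μ * b * (1 - t) := mul_nonneg (by positivity) (by linarith)
      have h3 : (ζbar + 8 / 9 * (1 - ζbar)) * μ ≤ μ := by
        linarith [mul_nonneg (sub_nonneg.2 hζ1.le) hμ0.le]
      rw [one_mul, one_mul] at hG
      linarith
  · have h1 : |a * e| ≤ LH / 2 * (c ^ 2 * εg) := by
      rw [abs_mul, abs_of_pos ha0]
      exact (mul_le_of_le_one_left (abs_nonneg _) ha1).trans (he.trans heb)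
    have h2 : |μ * b * (1 - t)| ≤ μ * (1 + c) := by
      rw [abs_of_nonneg (mul_nonneg (by positivity) (by linarith))]
      have : b * (1 - t) ≤ 1 * (1 + c) := by
        refine mul_le_mul hb1 (by linarith) (by linarith) (by norm_num)
      linarith [mul_le_mul_of_nonneg_left this hμ0.le]
    obtain ⟨h3, h4⟩ := abs_le.1 h1
    obtain ⟨h5, h6⟩ := abs_le.1 h2
    have hLc : LH / 2 * c ^ 2 ≤ LH * c / 18 := by
      linarith [mul_le_mul_of_nonneg_left hc9 (by positivity : 0 ≤ LH * c)]
    have hζμ : ζbar * μ ≤ μ := mul_le_of_le_one_left hμ0.le hζ1.le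
    -- The third entry of c_d keeps the sum at 3/4 of ε_g, which leaves room for the factor 1 + δ ≤
    -- 10/9.
    have htot : LH / 2 * (c ^ 2 * εg) + μ + μ * (1 + c) + 2 * (c * εg) ≤ 3 / 4 * εg := by
      have : LH / 2 * c ^ 2 + c / 4 + 2 * c ≤ 1 / 4 := by
        linarith [mul_pos hc0 hLH]
      rw [hμ]
      linarith [mul_le_mul_of_nonneg_right this hεg.le]
    have hfin : |a * G| ≤ 3 / 4 * εg := by
      rw [hG]
      exact abs_le.2 ⟨by linarith, by linarith⟩
    have h10 : 1 + δ ≤ 10 / 9 := by linarith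
    calc (1 + δ) * |a * G| ≤ 10 / 9 * (3 / 4 * εg) := by gcongr
      _ ≤ εg := by linarith

/-- The Newton residual, solved for the gradient at the new point, expresses it coordinatewise by
the Taylor error, the residual, the barrier term and the shift 2εd; `coordinate_bounds` estimates
these. -/
theorem firstOrder_of_short_step (P : Params) {n : ℕ} {f : E n → ℝ} {Ω : Set (E n)}
    {LH εg ε μ : ℝ} (hLH : 0 < LH) (hΩ : IsOpen Ω) (hf : ContDiffOn ℝ 2 f Ω)
    (hL : ∀ x ∈ Ω, ∀ y ∈ Ω, ‖hess f x - hess f y‖ ≤ LH * ‖x - y‖)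
    (hεg : 0 < εg) (hε0 : 0 < ε) (hε : ε ^ 2 = εg) (hε1 : ε < 1) (hμ : μ = εg / 4)
    {x d : E n} (hx : ∀ i, 0 < x i) (hseg : segment ℝ x (x + barX x d) ⊆ Ω)
    (hd : supNorm (relStep x d) ≤ P.β) (hdn : ‖d‖ ≤ cD P LH * ε)
    (hr : supNorm (scaledGrad f μ x + CG.shift (scaledHess f μ x) ε d) ≤ P.ζbar * μ) :
    FirstOrder f εg (x + barX x d) := by
  have hpos : ∀ i, 0 < (x + barX x d) i := fun i => by
    simpa using step_pos hx P.β_mem.2 hd (t := 1) (by simp) i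
  have htay := gradient_taylor hΩ hf hL hseg (t := 1) (by simp)
  simp only [one_smul, one_pow, mul_one] at htay
  have hnb : ‖barX x d‖ ^ 2 ≤ ‖d‖ ^ 2 :=
    pow_le_pow_left₀ (norm_nonneg _) (norm_barX_le hx d) 2
  have key : ∀ i, -εg ≤ (∇ f (x + barX x d)) i ∧
      (1 + ‖d‖) * |min (x i) 1 * (∇ f (x + barX x d)) i| ≤ εg := by
    intro i
    have hxi := hx i
    obtain ⟨hb0, hb1⟩ := ratio_mem hx i
    refine coordinate_bounds (LH := LH) (ζbar := P.ζbar) (ζr := P.ζr) (c := cD P LH) (μ := μ)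
      (ε := ε) (b := (x i)⁻¹ * min (x i) 1) (t := relStep x d i)
      (e := (∇ f (x + barX x d) - ∇ f x - hess f x (barX x d)) i)
      (r := (scaledGrad f μ x + CG.shift (scaledHess f μ x) ε d) i) (di := d i)
      hLH P.ζbar_mem.1 P.ζbar_mem.2 P.ζr_mem.1 hεg hε0 hε hε1 hμ (cD_pos P hLH)
      (min_le_left _ _) ((min_le_right _ _).trans (min_le_left _ _))
      ((min_le_right _ _).trans (min_le_right _ _)) (norm_nonneg _) hdn (lt_min hxi one_pos)
      (min_le_right _ _) hb0 hb1 ?_ ((abs_relStep_le hx d i).trans (abs_apply_le_norm d i)) ?_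
      ((abs_apply_le_supNorm _ i).trans hr) (abs_apply_le_norm d i) ?_
    · rcases le_total (x i) 1 with h | h
      · left; rw [min_eq_left h, inv_mul_cancel₀ hxi.ne']
      · right; exact min_eq_right h
    · refine (abs_apply_le_norm _ i).trans (htay.trans ?_)
      exact mul_le_mul_of_nonneg_left hnb (by positivity)
    · simp only [CG.shift, scaledGrad, scaledHess, hessPhi, gradPhi, PiLp.add_apply,
        PiLp.sub_apply, PiLp.smul_apply, smul_eq_mul, ContinuousLinearMap.comp_apply,
        add_apply, smul_apply, barX_apply, invX_apply, relStep_apply]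
      ring
  refine ⟨hpos, fun i => (key i).1, supNorm_le hεg.le fun i => ?_⟩
  refine le_trans ?_ (key i).2
  have hxi := hx i
  have hrel : relStep x d i ≤ ‖d‖ :=
    (le_abs_self _).trans ((abs_relStep_le hx d i).trans (abs_apply_le_norm d i))
  -- The bound must hold with the scaling at the new point, which may exceed the old one by the
  -- factor 1 + ‖d‖.
  have hmin : min ((x + barX x d) i) 1 ≤ (1 + ‖d‖) * min (x i) 1 := by
    have h1 := add_smul_barX_apply hx d 1 i
    rw [one_smul, one_mul] at h1
    rcases le_total (x i) 1 with h | h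
    · refine (min_le_left _ _).trans ?_
      rw [h1, min_eq_left h, mul_comm]
      gcongr
    · refine (min_le_right _ _).trans ?_
      rw [min_eq_right h]
      linarith [norm_nonneg d]
  rw [barX_apply, abs_mul, abs_mul, abs_of_pos (lt_min (hpos i) one_pos),
    abs_of_pos (lt_min hxi one_pos), ← mul_assoc]
  exact mul_le_mul_of_nonneg_right hmin (abs_nonneg _)

namespace Input

/-! ### One iteration of the algorithm -/

section Iteration

variable {P : Params} {n : ℕ} (A : Input P n)

theorem callsCG_of_not_firstOrder {x : E n} (hx : ∀ i, 0 < x i) (h : ¬ FirstOrder A.f A.εg x) :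
    A.CallsCG x := by
  by_contra hc
  rw [CallsCG] at hc
  push Not at hc
  exact h ⟨hx, fun i => (hc.1 i).le, hc.2⟩

/-- If g = 0 then ∇f = μX⁻¹e is positive, and X̄∇f has entries at most μ < ε_g, so neither test
would call the method. -/
theorem g_ne_zero {x : E n} (hx : ∀ i, 0 < x i) (h : A.CallsCG x) : A.g x ≠ 0 := by
  intro h0
  have hεg := A.εg_mem.1
  have hμ := A.μ_pos
  have hcoord : ∀ i, min (x i) 1 * ((∇ A.f x) i - A.μ * (x i)⁻¹) = 0 := by
    intro i
    have := congrArg (fun v : E n => v i) h0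
    simpa only [g, scaledGrad, gradPhi, barX_apply, PiLp.sub_apply, PiLp.smul_apply, smul_eq_mul,
      PiLp.zero_apply] using this
  rcases h with ⟨i, hi⟩ | h
  · rcases mul_eq_zero.1 (hcoord i) with h1 | h1
    · exact (lt_min (hx i) one_pos).ne' h1
    · have : 0 < A.μ * (x i)⁻¹ := mul_pos hμ (inv_pos.2 (hx i))
      linarith
  · refine absurd (supNorm_le hεg.le fun i => ?_) (not_le.2 h)
    obtain ⟨h1, h2⟩ := ratio_mem hx i
    have e : min (x i) 1 * (∇ A.f x) i = A.μ * ((x i)⁻¹ * min (x i) 1) := by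
      linarith [hcoord i]
    rw [barX_apply, e, abs_of_pos (mul_pos hμ h1)]
    refine (mul_le_of_le_one_right hμ.le h2).trans ?_
    unfold μ
    linarith

/-- Negative curvature gives ‖d‖ ≥ ε_H and t ≥ c_nc. For a Newton step, backtracking bounds t‖d‖
below directly; with t = 1 either d is long, or it is shorter than c_d ε_H and the new point is
first-order. -/
theorem step_spec {LH B : ℝ} (hLH : 0 < LH) (hA : A.SmoothOnPath LH) (hM : A.MBounded B) {k : ℕ}
    {x : E n} (hit : A.iterate k = some x) (hx : ∀ i, 0 < x i) (hcall : A.CallsCG x) :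
    ∃ o, A.cg k x = some o ∧
      (∀ R, ‖A.g x‖ ≤ R → o.products ≤ 2 * min n (CG.capJ B A.εH P.ζr A.cμ R)) ∧
      ∃ d, ∃ t ∈ Set.Ioc (0 : ℝ) 1, A.iterate (k + 1) = some (x + t • barX x d) ∧
        supNorm (relStep x d) ≤ P.β ∧
        phi A.f A.μ (x + t • barX x d) ≤ phi A.f A.μ x - P.η / 6 * (t * ‖d‖) ^ 3 ∧
        (cAll P LH * A.εH ≤ t * ‖d‖ ∨ FirstOrder A.f A.εg (x + t • barX x d)) := by
  classical
  obtain ⟨Ω, hΩ, hin, hsegs, hf, -, hL⟩ := hA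
  have hε := A.εH_pos
  have hη := P.η_mem.1
  have hC := cubicCoeff_pos P hLH
  have hβ := P.β_mem
  obtain ⟨o, ho, hvalid, hprod⟩ := CG.run_spec
    (scaledHess_symm hΩ hf A.μ (hin k x hit)) hε (add_nonneg A.Mhat_nonneg A.μ_pos.le)
    P.ζr_mem.1 P.ζr_mem.2 A.cμ_pos (A.g_ne_zero hx hcall) (hM k x hit hcall) (A.pick_mem k)
  change A.cg k x = some o at ho
  refine ⟨o, ho, hprod, ?_⟩
  have hdir : A.direction k x = some (A.scaleCG x o) := by
    rw [direction, if_pos hcall, ho]; rfl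
  have hseg := hsegs k x _ hit hdir
  have hnext : ∀ z, A.lineSearch x (A.scaleCG x o) = some z → A.iterate (k + 1) = some z := by
    intro z hz
    simp [iterate, hit, hdir, hz]
  obtain ⟨ty, v, np⟩ := o
  have hd : ∃ d, d = A.scaleCG x ⟨ty, v, np⟩ := ⟨_, rfl⟩
  obtain ⟨d, hd⟩ := hd
  rw [← hd] at hseg hnext
  cases ty with
  | nc =>
    obtain ⟨h1, h2, h3, h4⟩ := nc_scaling hε A.sqrt_le_β hx hvalid (abs_sgn _)
      (sgn_mul_self _) hd
    have hN : 0 < ‖d‖ := hε.trans_le h2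
    obtain ⟨t, ht, hls, hdec, htb⟩ := A.exists_lineSearch (x := x) (d := d)
      (b := 3 / (cubicCoeff LH P.β + P.η)) (by positivity) (fun t ht htb =>
        (phi_taylor hLH.le hΩ hf hL hx hseg hβ.1.le hβ.2 h1 A.μ_pos.le A.μ_le
          ⟨ht.1.le, ht.2⟩).trans_lt (nc_decrease hη hC hN h3 h4 ht.1 htb))
    refine ⟨d, t, ht, hnext _ hls, h1, by rw [mul_pow, ← mul_assoc]; exact hdec.le, Or.inl ?_⟩
    have htc : cAll P LH ≤ t := by
      refine (min_le_right _ _).trans ?_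
      rw [cNc_eq P hLH]
      rcases htb with rfl | htb
      · exact min_le_left _ _
      · refine (min_le_right _ _).trans (le_trans (le_of_eq ?_) htb)
        ring
    exact mul_le_mul htc h2 hε.le ht.1.le
  | sol =>
    obtain ⟨hv0, hlow, hgv, hsup⟩ := hvalid
    obtain ⟨h1, h2, h3, h4⟩ := sol_scaling hε hβ.1 hx hv0 hlow hgv hd
    have hN : 0 < ‖d‖ := norm_pos_iff.2 h2
    obtain ⟨t, ht, hls, hdec, htb⟩ := A.exists_lineSearch (x := x) (d := d)
      (b := 6 * A.εH / ((cubicCoeff LH P.β + P.η) * ‖d‖)) (by positivity) (fun t ht htb =>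
        (phi_taylor hLH.le hΩ hf hL hx hseg hβ.1.le hβ.2 h1 A.μ_pos.le A.μ_le
          ⟨ht.1.le, ht.2⟩).trans_lt (sol_decrease hη hC hN ht.1 ht.2 (h4 t ht) htb))
    refine ⟨d, t, ht, hnext _ hls, h1, by rw [mul_pow, ← mul_assoc]; exact hdec.le, ?_⟩
    have hle := min_le_left (cSol P LH) (cNc P LH)
    rw [← cAll, cSol_eq P hLH] at hle
    rcases htb with rfl | htb
    · rcases le_or_gt (cD P LH * A.εH) ‖d‖ with hlong | hshort
      · left
        rw [one_mul]
        exact (mul_le_mul_of_nonneg_right (hle.trans (min_le_left _ _)) hε.le).trans hlong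
      · right
        have hc1 : cD P LH ≤ 1 := (min_le_left _ _).trans (by linarith [P.ζbar_mem.1])
        have hdv : d = v := h3 (hshort.trans_le
          ((mul_le_of_le_one_left hε.le hc1).trans A.sqrt_le_β))
        rw [one_smul]
        refine firstOrder_of_short_step P hLH hΩ hf hL A.εg_mem.1 hε A.εH_sq A.εH_lt_one rfl hx
          hseg h1 hshort.le ?_
        rw [hdv]
        exact hsup
    · left
      have hθ := P.θ_mem
      have h5 : P.θ * (6 * A.εH / ((cubicCoeff LH P.β + P.η) * ‖d‖)) * ‖d‖ ≤ t * ‖d‖ :=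
        mul_le_mul_of_nonneg_right htb hN.le
      refine le_trans ?_ h5
      refine (mul_le_mul_of_nonneg_right (hle.trans (min_le_right _ _)) hε.le).trans ?_
      have e : P.θ * (6 * A.εH / ((cubicCoeff LH P.β + P.η) * ‖d‖)) * ‖d‖ =
          6 * P.θ / (cubicCoeff LH P.β + P.η) * A.εH := by
        field_simp
      rw [e]
      -- The argument yields one factor θ; c_sol asks for less.
      have hθ2 : P.θ ^ 2 ≤ P.θ := pow_le_of_le_one hθ.1.le hθ.2.le two_ne_zero
      gcongr

/-! ### Counting the iterations -/

theorem sum_abs_le {v : E n} : ∑ i, |v i| ≤ √n * ‖v‖ := by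
  have h := Finset.sum_mul_sq_le_sq_mul_sq Finset.univ (fun _ : Fin n => (1 : ℝ)) fun i => |v i|
  simp only [one_mul, one_pow, Finset.sum_const, Finset.card_univ, Fintype.card_fin, nsmul_eq_mul,
    mul_one] at h
  have h2 := EuclideanSpace.norm_sq_eq v
  simp only [Real.norm_eq_abs] at h2
  rw [← h2] at h
  rw [← Real.sqrt_sq (norm_nonneg v), ← Real.sqrt_mul (Nat.cast_nonneg n)]
  exact Real.le_sqrt_of_sq_le h

theorem exists_iterate {LH B : ℝ} (hLH : 0 < LH) (hA : A.SmoothOnPath LH) (hM : A.MBounded B)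
    {k : ℕ} (h : ∀ l < k, ∀ z, A.iterate l = some z → ¬ FirstOrder A.f A.εg z) :
    ∃ x, A.iterate k = some x ∧ ∀ i, 0 < x i := by
  induction k with
  | zero => exact ⟨A.x0, rfl, A.x0_pos⟩
  | succ k ih =>
    obtain ⟨x, hx, hpos⟩ := ih fun l hl => h l (by omega)
    obtain ⟨o, -, -, d, t, ht, hit, hβ, -, -⟩ := A.step_spec hLH hA hM hx hpos
      (A.callsCG_of_not_firstOrder hpos (h k (by omega) x hx))
    exact ⟨_, hit, step_pos hpos P.β_mem.2 hβ ⟨ht.1.le, ht.2⟩⟩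

/-- S accumulates the cubes s³. As s ≥ δ, with δ = c_all ε_H, each s is at most s³/δ², so S controls
the growth of the coordinates as well as the decrease of φ_μ. -/
theorem exists_progress {LH B : ℝ} (hLH : 0 < LH) (hA : A.SmoothOnPath LH) (hM : A.MBounded B)
    {k : ℕ} (h : ∀ l ≤ k, ∀ z, A.iterate l = some z → ¬ FirstOrder A.f A.εg z) :
    ∃ x S, A.iterate k = some x ∧ (∀ i, 0 < x i) ∧ k * (cAll P LH * A.εH) ^ 3 ≤ S ∧
      phi A.f A.μ x ≤ phi A.f A.μ A.x0 - P.η / 6 * S ∧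
      ∑ i, x i ≤ ∑ i, A.x0 i + √n * (S / (cAll P LH * A.εH) ^ 2) := by
  have hδ : 0 < cAll P LH * A.εH := mul_pos (cAll_pos P hLH) A.εH_pos
  set δ := cAll P LH * A.εH
  induction k with
  | zero => exact ⟨A.x0, 0, rfl, A.x0_pos, by simp, by simp, by simp⟩
  | succ k ih =>
    obtain ⟨x, S, hx, hpos, hS, hphi, hsum⟩ := ih fun l hl => h l (by omega)
    obtain ⟨o, -, -, d, t, ht, hit, hβ, hdec, hlong⟩ := A.step_spec hLH hA hM hx hpos
      (A.callsCG_of_not_firstOrder hpos (h k (by omega) x hx))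
    have hs := hlong.resolve_right (h (k + 1) le_rfl _ hit)
    set s := t * ‖d‖
    refine ⟨_, S + s ^ 3, hit, step_pos hpos P.β_mem.2 hβ ⟨ht.1.le, ht.2⟩, ?_, ?_, ?_⟩
    · have := pow_le_pow_left₀ hδ.le hs 3
      push_cast
      linarith
    · linarith
    · have h1 : ∑ i, (x + t • barX x d) i ≤ ∑ i, x i + t * ∑ i, |barX x d i| := by
        rw [Finset.mul_sum, ← Finset.sum_add_distrib]
        refine Finset.sum_le_sum fun i _ => ?_
        rw [PiLp.add_apply, PiLp.smul_apply, smul_eq_mul]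
        linarith [mul_le_mul_of_nonneg_left (le_abs_self (barX x d i)) ht.1.le]
      have h2 : t * ∑ i, |barX x d i| ≤ √n * s := by
        have h3 := (sum_abs_le (v := barX x d)).trans
          (mul_le_mul_of_nonneg_left (norm_barX_le hpos d) (Real.sqrt_nonneg _))
        have := mul_le_mul_of_nonneg_left h3 ht.1.le
        exact this.trans (le_of_eq (by ring))
      have h4 : s ≤ s ^ 3 / δ ^ 2 := by
        rw [le_div_iff₀ (by positivity)]
        have := pow_le_pow_left₀ hδ.le hs 2
        nlinarith
      have h5 := mul_le_mul_of_nonneg_left h4 (Real.sqrt_nonneg (n : ℝ))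
      have e : √n * ((S + s ^ 3) / δ ^ 2) = √n * (S / δ ^ 2) + √n * (s ^ 3 / δ ^ 2) := by ring
      rw [e]
      linarith

theorem εg_rpow_mul : A.εg ^ (-(3 / 2) : ℝ) * A.εH ^ 3 = 1 := by
  have h := A.εg_mem.1
  rw [εH, Real.sqrt_eq_rpow, ← Real.rpow_natCast, ← Real.rpow_mul h.le, ← Real.rpow_add h]
  norm_num

theorem omega1_pos {LH : ℝ} (hn : 0 < n) : 0 < A.omega1 LH := by
  refine lt_of_lt_of_le ?_ (le_max_right _ _)
  exact (abs_pos.2 (A.x0_pos ⟨0, hn⟩).ne').trans_le (abs_apply_le_supNorm _ _)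

/-- Otherwise K̄₁ + 1 long steps give (K̄₁ + 1)δ³ ≤ S, with δ = c_all ε_H, while the lower bound on
f and the control of the logarithms give S ≤ K̄₁δ³. -/
theorem exists_firstOrder {LH B flow : ℝ} (hn : 0 < n) (hLH : 0 < LH) (hA : A.SmoothOnPath LH)
    (hflow : A.BoundedBelow flow) (hM : A.MBounded B) :
    ∃ k ≤ A.K1 LH flow + 1, ∃ x, A.iterate k = some x ∧ FirstOrder A.f A.εg x := by
  by_contra! hno
  have hη := P.η_mem.1
  have hc := cAll_pos P hLH
  have hε := A.εH_pos
  have hμ := A.μ_pos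
  obtain ⟨x, S, -, hpos, hS, hphi, hsum⟩ := A.exists_progress hLH hA hM hno
  have hω := A.omega1_pos (LH := LH) hn
  have hω1 : 3 * √n / (P.η * cAll P LH ^ 2) ≤ A.omega1 LH := le_max_left _ _
  have hω2 : ∀ i, A.x0 i ≤ A.omega1 LH := fun i =>
    (le_abs_self _).trans ((abs_apply_le_supNorm _ i).trans (le_max_right _ _))
  set K := A.K1 LH flow with hK
  rw [K1] at hK
  set ω := A.omega1 LH
  set c := cAll P LH
  set m := ⨅ i, Real.log (A.x0 i)
  have hS0 : 0 ≤ S := le_trans (by positivity) hS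
  have hlogx : ∑ i, Real.log (x i) ≤ n * Real.log ω + (∑ i, x i) / ω - n := by
    have : ∀ i, Real.log (x i) ≤ Real.log ω + x i / ω - 1 := by
      intro i
      have := Real.log_le_sub_one_of_pos (div_pos (hpos i) hω)
      rw [Real.log_div (hpos i).ne' hω.ne'] at this
      linarith
    refine (Finset.sum_le_sum fun i _ => this i).trans (le_of_eq ?_)
    simp [Finset.sum_sub_distrib, Finset.sum_add_distrib, Finset.sum_div]
  have hlog0 : n * m ≤ ∑ i, Real.log (A.x0 i) := by
    have : ∑ _i : Fin n, m ≤ ∑ i, Real.log (A.x0 i) :=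
      Finset.sum_le_sum fun i _ => ciInf_le (Set.finite_range _).bddBelow i
    simpa using this
  have hx0sum : ∑ i, A.x0 i ≤ n * ω := by
    have : ∑ i, A.x0 i ≤ ∑ _i : Fin n, ω := Finset.sum_le_sum fun i _ => hω2 i
    simpa using this
  have hsumω : (∑ i, x i) / ω ≤ n + √n * (S / (c * A.εH) ^ 2) / ω := by
    rw [div_le_iff₀ hω, add_mul, div_mul_cancel₀ _ hω.ne']
    linarith
  -- As μ = ε_g/4 and ε_H² = ε_g, the left side is √n S/(4c²ω); the first entry of ω₁ is chosen so
  -- that this is at most half of ηS/6.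
  have habsorb : A.μ * (√n * (S / (c * A.εH) ^ 2) / ω) ≤ P.η / 12 * S := by
    rw [div_le_iff₀ (by positivity)] at hω1
    have e : A.μ * (√n * (S / (c * A.εH) ^ 2) / ω) = 3 * √n * (S / (12 * (c ^ 2 * ω))) := by
      rw [mul_pow, A.εH_sq, μ]
      have := A.εg_mem.1
      field_simp
      ring
    rw [e]
    calc 3 * √n * (S / (12 * (c ^ 2 * ω)))
        ≤ ω * (P.η * c ^ 2) * (S / (12 * (c ^ 2 * ω))) := by gcongr
      _ = P.η / 12 * S := by field_simp
  have hμlog := mul_le_mul_of_nonneg_left hlogx hμ.le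
  have hμlog0 := mul_le_mul_of_nonneg_left hlog0 hμ.le
  have hμsum := mul_le_mul_of_nonneg_left hsumω hμ.le
  have hfl := hflow x hpos
  simp only [phi] at hphi
  have hW : P.η / 12 * S ≤ A.μ * n * (Real.log ω - m) + A.f A.x0 - flow := by
    linarith
  have hceil := Nat.le_ceil (12 * (A.μ * n * (Real.log ω - m) + A.f A.x0 - flow) /
    (P.η * c ^ 3) * A.εg ^ (-(3 / 2) : ℝ))
  rw [← hK] at hceil
  generalize A.μ * n * (Real.log ω - m) + A.f A.x0 - flow = W at *
  have h1 := mul_le_mul_of_nonneg_right hceil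
    (by positivity : 0 ≤ P.η / 12 * (c * A.εH) ^ 3)
  have e : 12 * W / (P.η * c ^ 3) * A.εg ^ (-(3 / 2) : ℝ) * (P.η / 12 * (c * A.εH) ^ 3) =
      W * (A.εg ^ (-(3 / 2) : ℝ) * A.εH ^ 3) := by
    field_simp
  rw [e, A.εg_rpow_mul, mul_one] at h1
  push_cast at hS
  have h2 := mul_le_mul_of_nonneg_left hS (by positivity : 0 ≤ P.η / 12)
  have h3 : 0 < P.η / 12 * (c * A.εH) ^ 3 := by positivity
  linarith

/-! ### Counting gradient evaluations and Hessian-vector products -/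

theorem iterCost_le {LH B : ℝ} (hLH : 0 < LH) (hA : A.SmoothOnPath LH)
    (hM : A.MBounded B) {k : ℕ} {x : E n} (hit : A.iterate k = some x) (hx : ∀ i, 0 < x i)
    (hcall : A.CallsCG x) {R : ℝ} (hR : ‖A.g x‖ ≤ R) :
    A.iterCost k ≤ 2 * min n (CG.capJ B A.εH P.ζr A.cμ R) + 1 := by
  obtain ⟨o, ho, hprod, -⟩ := A.step_spec hLH hA hM hit hx hcall
  have e : A.iterCost k = 1 + o.products := by
    simp [iterCost, hit, hcall, ho]
  rw [e, add_comm]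
  exact Nat.add_le_add_right (hprod R hR) 1

/-- At most K + 1 iterations, each with one gradient, and one last gradient, which the step from 2
min(n, J) + 1 to 2 min(n, J) + 2 covers. -/
theorem work_le {LH B : ℝ} (hLH : 0 < LH) (hA : A.SmoothOnPath LH)
    (hM : A.MBounded B) {k K : ℕ} (hk : k ≤ K + 1)
    (h : ∀ l < k, ∀ z, A.iterate l = some z → ¬ FirstOrder A.f A.εg z) {R : ℝ}
    (hR : ∀ l < k, ∀ z, A.iterate l = some z → ‖A.g z‖ ≤ R) :
    A.work k ≤ (2 * min n (CG.capJ B A.εH P.ζr A.cμ R) + 2) * (K + 1) := by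
  have hcost : ∀ l ∈ Finset.range k,
      A.iterCost l ≤ 2 * min n (CG.capJ B A.εH P.ζr A.cμ R) + 1 := by
    intro l hl
    rw [Finset.mem_range] at hl
    obtain ⟨x, hx, hpos⟩ := A.exists_iterate hLH hA hM fun i hi => h i (hi.trans hl)
    exact A.iterCost_le hLH hA hM hx hpos
      (A.callsCG_of_not_firstOrder hpos (h l hl x hx)) (hR l hl x hx)
  have hsum := Finset.sum_le_card_nsmul _ _ _ hcost
  rw [Finset.card_range, smul_eq_mul] at hsum
  rw [work]
  have hk2 := Nat.mul_le_mul_right (2 * min n (CG.capJ B A.εH P.ζr A.cμ R) + 1) hk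
  calc _ ≤ (K + 1) * (2 * min n (CG.capJ B A.εH P.ζr A.cμ R) + 1) + 1 :=
      Nat.add_le_add_right (hsum.trans hk2) 1
    _ ≤ _ := by ring_nf; omega

end Iteration

end Input

/-! ### Order estimates -/

namespace CG

/-- 1 - τ ≥ 1/(2√κ) gives the exponential, and 1 - √τ ≥ (1 - τ)/2 gives √T ≤ 8κ^{5/2}. -/
theorem slowFactor_le {M ε : ℝ} (hε : 0 < ε) (hM : 0 ≤ M) (N : ℕ) :
    √(capT M ε) * tau M ε ^ ((N : ℝ) / 2) ≤
      8 * kappa M ε ^ 3 * Real.exp (-(N / (4 * √(kappa M ε)))) := by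
  have hκ := two_le_kappa hε hM
  have hτ := tau_pos hε hM
  have h1τ := one_sub_tau M ε
  have hs1 : 1 ≤ √(kappa M ε) := Real.one_le_sqrt.2 (by linarith)
  have hsq := Real.sq_sqrt (by linarith : 0 ≤ kappa M ε)
  have hτ' : 1 / (2 * √(kappa M ε)) ≤ 1 - tau M ε := by
    rw [h1τ]
    exact one_div_le_one_div_of_le (by linarith) (by linarith)
  have hst := Real.sq_sqrt hτ.le
  have hst1 := sqrt_tau_lt_one M ε
  have hst0 := Real.sqrt_nonneg (tau M ε)
  have hroot : 1 / (4 * √(kappa M ε)) ≤ 1 - √(tau M ε) := by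
    have e : 1 / (4 * √(kappa M ε)) = 1 / (2 * √(kappa M ε)) / 2 := by
      field_simp; norm_num
    rw [e]
    nlinarith
  have hT : √(capT M ε) ≤ 8 * kappa M ε ^ 3 := by
    rw [Real.sqrt_le_left (by positivity), capT]
    calc 4 * kappa M ε ^ 4 / (1 - √(tau M ε)) ^ 2
        ≤ 4 * kappa M ε ^ 4 / (1 / (4 * √(kappa M ε))) ^ 2 := by gcongr
      _ = 64 * kappa M ε ^ 5 := by
        rw [div_pow, mul_pow, hsq]
        field_simp
        norm_num
      _ ≤ 64 * kappa M ε ^ 6 := by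
        have := pow_le_pow_right₀ (by linarith : 1 ≤ kappa M ε) (by norm_num : 5 ≤ 6)
        linarith
      _ = (8 * kappa M ε ^ 3) ^ 2 := by ring
  have hexp : tau M ε ^ ((N : ℝ) / 2) ≤ Real.exp (-(N / (4 * √(kappa M ε)))) := by
    rw [Real.rpow_def_of_pos hτ]
    refine Real.exp_le_exp.2 ?_
    have hlog := Real.log_le_sub_one_of_pos hτ
    have h2 : Real.log (tau M ε) ≤ -(1 / (2 * √(kappa M ε))) := by linarith
    have h3 := mul_le_mul_of_nonneg_right h2 (by positivity : 0 ≤ (N : ℝ) / 2)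
    refine h3.trans (le_of_eq ?_)
    field_simp
    ring
  exact mul_le_mul hT hexp (Real.rpow_nonneg hτ.le _) (by positivity)

/-- R is not assumed positive: when no call precedes x^k, any R is a bound. -/
theorem capJ_eq_zero {M ε ζr cμ R : ℝ} (hε : 0 < ε) (hM : 0 ≤ M) (hζ1 : ζr < 1) (hc : 0 < cμ)
    (hR : R ≤ 0) : capJ M ε ζr cμ R = 0 := by
  refine Nat.eq_zero_of_le_zero (Nat.sInf_le ?_)
  have h1 := one_le_sqrt_capT hε hM
  have h2 := zetaHat_lt_one hε hM hζ1
  simp only [Nat.cast_zero, zero_div, Real.rpow_zero, mul_one, Set.mem_ofPred_eq]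
  refine le_min (mul_le_mul_of_nonpos_right (by linarith) hR) (le_trans ?_ hc.le)
  exact mul_nonpos_of_nonneg_of_nonpos (by linarith) hR

/-- A logarithmic bound for `J`. -/
theorem capJ_le {M ε ζr cμ R Λ : ℝ} (hε : 0 < ε) (hM : 0 ≤ M) (hζ : 0 < ζr) (hζ1 : ζr < 1)
    (hc : 0 < cμ) (hΛ0 : 0 ≤ Λ)
    (hΛ : 8 * kappa M ε ^ 3 * (3 * kappa M ε / ζr + R / cμ) ≤ Real.exp Λ) :
    (capJ M ε ζr cμ R : ℝ) ≤ 4 * √(kappa M ε) * Λ + 1 := by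
  have hκ := two_le_kappa hε hM
  rcases le_or_gt R 0 with hR | hR
  · rw [capJ_eq_zero hε hM hζ1 hc hR, Nat.cast_zero]
    positivity
  have hs1 : 1 ≤ √(kappa M ε) := Real.one_le_sqrt.2 (by linarith)
  refine le_trans (Nat.cast_le.2 (Nat.sInf_le ?_ :
    capJ M ε ζr cμ R ≤ ⌈4 * √(kappa M ε) * Λ⌉₊)) (Nat.ceil_lt_add_one (by positivity)).le
  rw [Set.mem_ofPred_eq]
  set N := ⌈4 * √(kappa M ε) * Λ⌉₊
  have hN : Λ ≤ N / (4 * √(kappa M ε)) := by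
    rw [le_div_iff₀ (by positivity), mul_comm]
    exact Nat.le_ceil _
  have hF : √(capT M ε) * tau M ε ^ ((N : ℝ) / 2) ≤ 8 * kappa M ε ^ 3 * Real.exp (-Λ) :=
    (slowFactor_le hε hM N).trans
      (mul_le_mul_of_nonneg_left (Real.exp_le_exp.2 (neg_le_neg hN)) (by positivity))
  set F := √(capT M ε) * tau M ε ^ ((N : ℝ) / 2)
  have hF0 : 0 ≤ F := mul_nonneg (Real.sqrt_nonneg _) (Real.rpow_nonneg (tau_pos hε hM).le _)
  -- The sum of the reciprocals of the two thresholds, relative to R, lets one logarithm serve both.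
  have hprod : F * (3 * kappa M ε / ζr + R / cμ) ≤ 1 := by
    refine (mul_le_mul_of_nonneg_right hF (by positivity)).trans ?_
    have e : 8 * kappa M ε ^ 3 * Real.exp (-Λ) * (3 * kappa M ε / ζr + R / cμ) =
        8 * kappa M ε ^ 3 * (3 * kappa M ε / ζr + R / cμ) * Real.exp (-Λ) := by ring
    rw [e]
    refine (mul_le_mul_of_nonneg_right hΛ (Real.exp_pos _).le).trans ?_
    rw [← Real.exp_add, add_neg_cancel, Real.exp_zero]
  rw [mul_add] at hprod
  refine le_min (mul_le_mul_of_nonneg_right ?_ hR.le) ?_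
  · have : F * (3 * kappa M ε / ζr) ≤ 1 := by
      have : 0 ≤ F * (R / cμ) := by positivity
      linarith
    rw [zetaHat, le_div_iff₀ (by positivity)]
    rw [← mul_div_assoc, div_le_one hζ] at this
    exact this
  · have : F * (R / cμ) ≤ 1 := by
      have : 0 ≤ F * (3 * kappa M ε / ζr) := by positivity
      linarith
    rw [← mul_div_assoc, div_le_one hc] at this
    exact this

end CG

theorem one_le_one_add_log {n : ℕ} {εg : ℝ} (hn : 0 < n) (h0 : 0 < εg) (h1 : εg < 1) :
    1 ≤ (n : ℝ) / εg ∧ 1 ≤ 1 + Real.log (n / εg) := by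
  have hn1 : (1 : ℝ) ≤ n := by exact_mod_cast hn
  have h : 1 ≤ (n : ℝ) / εg := by rw [le_div_iff₀ h0]; linarith
  exact ⟨h, by linarith [Real.log_nonneg h]⟩

theorem one_le_rpow_neg_quarter {εg : ℝ} (h0 : 0 < εg) (h1 : εg < 1) :
    1 ≤ εg ^ (-(1 / 4) : ℝ) :=
  Real.one_le_rpow_of_pos_of_le_one_of_nonpos h0 h1.le (by norm_num)

theorem rpow_eq_quarter_pow {εg : ℝ} (h0 : 0 < εg) (m : ℕ) :
    (εg ^ (-(1 / 4) : ℝ)) ^ m = εg ^ (-(m / 4) : ℝ) := by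
  rw [← Real.rpow_natCast, ← Real.rpow_mul h0.le]
  congr 1
  ring

theorem sqrt_natCast_le {n : ℕ} (hn : 0 < n) : √(n : ℝ) ≤ n := by
  have hn1 : (1 : ℝ) ≤ n := by exact_mod_cast hn
  rw [Real.sqrt_le_left (by linarith)]
  nlinarith

/-- `J = Õ(ε_g^{-1/4})`. -/
theorem exists_capJ_bound (P : Params) {Ug UH : ℝ} (hUg : 0 < Ug) (hUH : 0 < UH) :
    ∃ C : ℝ, 0 < C ∧ ∀ (n : ℕ) (A : Input P n) (R : ℝ), 0 < n → R ≤ Ug + A.μ * √n →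
      (CG.capJ (UH + A.μ) A.εH P.ζr A.cμ R : ℝ) ≤
        C * (1 + Real.log (n / A.εg)) * A.εg ^ (-(1 / 4) : ℝ) := by
  have hζr := P.ζr_mem
  have hζb := P.ζbar_mem
  set k₀ := UH + 3 with hk₀
  have hk : 0 < k₀ := by positivity
  set C₁ := 8 * k₀ ^ 3 * (3 * k₀ / P.ζr + 4 * (Ug + 1) / P.ζbar) with hC₁
  have hC₁0 : 0 < C₁ := by
    have := hζr.1
    have := hζb.1
    positivity
  refine ⟨4 * √k₀ * (|Real.log C₁| + 4) + 1, by positivity, fun n A R hn hR => ?_⟩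
  obtain ⟨hε0, hε1⟩ := A.εg_mem
  obtain ⟨hY, hℓ⟩ := one_le_one_add_log hn hε0 hε1
  have hu := one_le_rpow_neg_quarter hε0 hε1
  have hn1 : (1 : ℝ) ≤ n := by exact_mod_cast hn
  have hεH := A.εH_pos
  have hεH1 := A.εH_lt_one
  have hM : 0 ≤ UH + A.μ := add_nonneg hUH.le A.μ_pos.le
  have hκ2 := CG.two_le_kappa hεH hM
  have hκ : CG.kappa (UH + A.μ) A.εH ≤ k₀ / A.εH := by
    have := A.μ_le
    unfold CG.kappa
    gcongr
    linarith
  have hκ' : CG.kappa (UH + A.μ) A.εH ≤ k₀ * (n / A.εg) := by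
    refine hκ.trans ?_
    rw [mul_div_assoc', div_le_div_iff₀ hεH hε0, ← A.εH_sq]
    have : A.εH ^ 2 ≤ n * A.εH := by nlinarith
    have := mul_le_mul_of_nonneg_left this hk.le
    linarith
  have hRc : R / A.cμ ≤ 4 * (Ug + 1) / P.ζbar * (n / A.εg) := by
    have hRn : R ≤ (Ug + 1) * n := by
      have h1 : A.μ * √n ≤ 1 * n :=
        mul_le_mul (by linarith [A.μ_le]) (sqrt_natCast_le hn) (Real.sqrt_nonneg _) one_pos.le
      nlinarith
    have hz := hζb.1
    refine (div_le_div_of_nonneg_right hRn A.cμ_pos.le).trans (le_of_eq ?_)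
    rw [Input.cμ, Input.μ]
    field_simp
  have hκr : 3 * CG.kappa (UH + A.μ) A.εH / P.ζr ≤ 3 * k₀ / P.ζr * (n / A.εg) := by
    have hz := hζr.1
    refine (div_le_div_of_nonneg_right (mul_le_mul_of_nonneg_left hκ' (by norm_num : (0:ℝ) ≤ 3))
      hz.le).trans (le_of_eq ?_)
    ring
  set κ := CG.kappa (UH + A.μ) A.εH
  set Y := (n : ℝ) / A.εg
  have hexp : 8 * κ ^ 3 * (3 * κ / P.ζr + R / A.cμ) ≤
      Real.exp ((|Real.log C₁| + 4) * (1 + Real.log Y)) := by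
    calc 8 * κ ^ 3 * (3 * κ / P.ζr + R / A.cμ)
        ≤ 8 * κ ^ 3 * (3 * k₀ / P.ζr * Y + 4 * (Ug + 1) / P.ζbar * Y) := by gcongr
      _ ≤ 8 * (k₀ * Y) ^ 3 * (3 * k₀ / P.ζr * Y + 4 * (Ug + 1) / P.ζbar * Y) := by
        have := hζr.1
        have := hζb.1
        have : 0 ≤ κ := by linarith
        gcongr
      _ = C₁ * Y ^ 4 := by rw [hC₁]; ring
      _ = Real.exp (Real.log C₁ + 4 * Real.log Y) := by
        rw [Real.exp_add, Real.exp_log hC₁0]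
        congr 1
        rw [← Real.exp_log (by linarith : 0 < Y), ← Real.exp_nat_mul, Real.log_exp]
        norm_num
      _ ≤ _ := by
        refine Real.exp_le_exp.2 ?_
        have h1 := le_abs_self (Real.log C₁)
        have h2 := Real.log_nonneg hY
        have h3 := abs_nonneg (Real.log C₁)
        nlinarith
  have hJ := CG.capJ_le hεH hM hζr.1 hζr.2 A.cμ_pos (by positivity) hexp
  change _ ≤ 4 * √κ * _ + 1 at hJ
  -- The source of the quarter power: κ ≤ k₀/ε_H with ε_H = ε_g^{1/2}.
  have hsκ : √κ ≤ √k₀ * A.εg ^ (-(1 / 4) : ℝ) := by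
    refine (Real.sqrt_le_sqrt hκ).trans (le_of_eq ?_)
    rw [Real.sqrt_div hk.le, Input.εH, div_eq_mul_inv, Real.sqrt_eq_rpow (√A.εg),
      Real.sqrt_eq_rpow A.εg, ← Real.rpow_mul hε0.le, ← Real.rpow_neg hε0.le]
    norm_num
  set u := A.εg ^ (-(1 / 4) : ℝ)
  set ℓ := 1 + Real.log Y
  refine hJ.trans ?_
  have h1 : 4 * √κ * ((|Real.log C₁| + 4) * ℓ) ≤
      4 * (√k₀ * u) * ((|Real.log C₁| + 4) * ℓ) := by gcongr
  have h2 : 1 ≤ ℓ * u := one_le_mul_of_one_le_of_one_le hℓ hu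
  linarith

/-- `K̄₁ = Õ(n ε_g^{-1/2} + ε_g^{-3/2})`. -/
theorem exists_K1_bound (P : Params) {LH : ℝ} (hLH : 0 < LH) (Δ a b : ℝ) (ha : 0 < a) :
    ∃ C : ℝ, 0 < C ∧ ∀ (n : ℕ) (A : Input P n) (flow : ℝ), 0 < n → A.f A.x0 - flow ≤ Δ →
      (∀ i, a ≤ A.x0 i ∧ A.x0 i ≤ b) →
      (A.K1 LH flow : ℝ) + 1 ≤ C * (1 + Real.log (n / A.εg)) *
        (n * (A.εg ^ (-(1 / 4) : ℝ)) ^ 2 + (A.εg ^ (-(1 / 4) : ℝ)) ^ 6) := by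
  have hη := P.η_mem.1
  have hc := cAll_pos P hLH
  set c := cAll P LH with hcdef
  set C₄ := 3 / (P.η * c ^ 2) + |b| + 1 with hC₄
  have hC₄0 : 0 < C₄ := by positivity
  set C₅ := |Real.log C₄| + 1 + |Real.log a| with hC₅
  have hC₅0 : 0 < C₅ := by positivity
  set D := 12 / (P.η * c ^ 3) with hD
  have hD0 : 0 < D := by positivity
  refine ⟨D * (C₅ + |Δ|) + 2, by positivity, fun n A flow hn hΔ hab => ?_⟩
  obtain ⟨hε0, hε1⟩ := A.εg_mem
  obtain ⟨hY, hℓ⟩ := one_le_one_add_log hn hε0 hε1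
  have hu := one_le_rpow_neg_quarter hε0 hε1
  have hn1 : (1 : ℝ) ≤ n := by exact_mod_cast hn
  have hμ := A.μ_pos
  have : Nonempty (Fin n) := ⟨⟨0, hn⟩⟩
  have hω : A.omega1 LH ≤ C₄ * n := by
    refine max_le ?_ ?_
    · have h1 : 3 * √n / (P.η * c ^ 2) ≤ 3 / (P.η * c ^ 2) * n := by
        rw [mul_div_right_comm]
        exact mul_le_mul_of_nonneg_left (sqrt_natCast_le hn) (by positivity)
      have h2 : 3 / (P.η * c ^ 2) * n ≤ C₄ * n :=
        mul_le_mul_of_nonneg_right (by linarith [abs_nonneg b]) (by linarith)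
      exact h1.trans h2
    · refine supNorm_le (by positivity) fun i => ?_
      rw [abs_of_pos (A.x0_pos i)]
      have h1 : |b| + 1 ≤ C₄ := by
        have : 0 ≤ 3 / (P.η * c ^ 2) := by positivity
        linarith
      have h2 := le_abs_self b
      have h3 := (hab i).2
      nlinarith [abs_nonneg b]
  have hlogn : Real.log n ≤ Real.log (n / A.εg) := by
    refine Real.log_le_log (by linarith) ?_
    rw [le_div_iff₀ hε0]
    nlinarith
  have hlogω : Real.log (A.omega1 LH) ≤ Real.log C₄ + Real.log n := by
    rw [← Real.log_mul hC₄0.ne' (by linarith)]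
    exact Real.log_le_log (A.omega1_pos hn) hω
  have hinf : Real.log a ≤ ⨅ i, Real.log (A.x0 i) :=
    le_ciInf fun i => Real.log_le_log ha (hab i).1
  set ℓ := 1 + Real.log (n / A.εg)
  have hdiff : Real.log (A.omega1 LH) - ⨅ i, Real.log (A.x0 i) ≤ C₅ * ℓ := by
    have h1 := le_abs_self (Real.log C₄)
    have h2 := neg_abs_le (Real.log a)
    have h3 : |Real.log C₄| + |Real.log a| ≤ (|Real.log C₄| + |Real.log a|) * ℓ :=
      le_mul_of_one_le_right (by positivity) hℓ
    have h4 : Real.log n ≤ 1 * ℓ := by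
      have : ℓ = 1 + Real.log (n / A.εg) := rfl
      linarith
    rw [hC₅]
    linarith
  have hW : A.μ * n * (Real.log (A.omega1 LH) - ⨅ i, Real.log (A.x0 i)) + A.f A.x0 - flow ≤
      (C₅ + |Δ|) * ℓ * (A.εg * n + 1) := by
    have h1 : A.μ * n * (Real.log (A.omega1 LH) - ⨅ i, Real.log (A.x0 i)) ≤
        A.μ * n * (C₅ * ℓ) := mul_le_mul_of_nonneg_left hdiff (by positivity)
    have h2 : A.μ * n * (C₅ * ℓ) ≤ A.εg * n * (C₅ * ℓ) := by
      have : A.μ ≤ A.εg := by unfold Input.μ; linarith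
      gcongr
    have h3 : |Δ| ≤ |Δ| * ℓ := le_mul_of_one_le_right (abs_nonneg _) hℓ
    have h4 := le_abs_self Δ
    have h5 : 0 ≤ C₅ * ℓ := by positivity
    have h6 : 0 ≤ |Δ| * ℓ * (A.εg * n) := by positivity
    linarith
  set u := A.εg ^ (-(1 / 4) : ℝ) with hudef
  have hu6 : A.εg ^ (-(3 / 2) : ℝ) = u ^ 6 := by
    rw [hudef, rpow_eq_quarter_pow hε0]
    norm_num
  -- The barrier part of K̄₁ carries μ, of order ε_g, which turns ε_g^{-3/2} into ε_g^{-1/2}.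
  have hεu : A.εg * u ^ 6 = u ^ 2 := by
    rw [hudef, rpow_eq_quarter_pow hε0, rpow_eq_quarter_pow hε0]
    nth_rewrite 1 [← Real.rpow_one A.εg]
    rw [← Real.rpow_add hε0]
    norm_num
  have hB0 : 0 ≤ D * ((C₅ + |Δ|) * ℓ * (A.εg * n + 1)) * u ^ 6 := by positivity
  have hK : (A.K1 LH flow : ℝ) ≤ D * ((C₅ + |Δ|) * ℓ * (A.εg * n + 1)) * u ^ 6 + 1 := by
    refine le_trans (Nat.cast_le.2 (Nat.ceil_mono ?_)) (Nat.ceil_lt_add_one hB0).le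
    rw [hu6, ← hcdef, mul_div_right_comm]
    exact mul_le_mul_of_nonneg_right (mul_le_mul_of_nonneg_left hW hD0.le) (by positivity)
  have e : D * ((C₅ + |Δ|) * ℓ * (A.εg * n + 1)) * u ^ 6 =
      D * (C₅ + |Δ|) * ℓ * (n * u ^ 2 + u ^ 6) := by
    rw [← hεu]; ring
  rw [e] at hK
  have h2 : 1 ≤ ℓ * (n * u ^ 2 + u ^ 6) := by
    have : 1 ≤ u ^ 6 := one_le_pow₀ hu
    have : 0 ≤ n * u ^ 2 := by positivity
    exact one_le_mul_of_one_le_of_one_le hℓ (by linarith)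
  linarith

theorem order_few {n J K : ℕ} {ℓ u C₁ C₂ : ℝ} (hℓ : 1 ≤ ℓ) (hu : 1 ≤ u) (hC₁ : 0 < C₁)
    (hJ : (J : ℝ) ≤ C₁ * ℓ * u)
    (hK : (K : ℝ) + 1 ≤ C₂ * ℓ * (n * u ^ 2 + u ^ 6)) (hJn : J < n) :
    (((2 * min n J + 2) * (K + 1) : ℕ) : ℝ) ≤
      6 * C₂ * (C₁ + 1) * ℓ ^ 2 * (u ^ 7 + n * u ^ 3) := by
  rw [min_eq_right hJn.le]
  push_cast
  have h1 : (1 : ℝ) ≤ ℓ * u := one_le_mul_of_one_le_of_one_le hℓ hu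
  have h2 : 2 * (J : ℝ) + 2 ≤ 6 * (C₁ + 1) * (ℓ * u) := by nlinarith
  calc (2 * (J : ℝ) + 2) * (K + 1)
      ≤ 6 * (C₁ + 1) * (ℓ * u) * (C₂ * ℓ * (n * u ^ 2 + u ^ 6)) := by gcongr
    _ = _ := by ring

/-- Here n ≤ J = Õ(u), so the term n u² in the iteration count is dominated by u⁶, up to a
logarithm. -/
theorem order_many {n J K : ℕ} {ℓ u C₁ C₂ : ℝ} (hℓ : 1 ≤ ℓ) (hu : 1 ≤ u) (hC₁ : 0 < C₁)
    (hC₂ : 0 < C₂) (hJ : (J : ℝ) ≤ C₁ * ℓ * u)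
    (hK : (K : ℝ) + 1 ≤ C₂ * ℓ * (n * u ^ 2 + u ^ 6)) (hn : 0 < n) (hJn : n ≤ J) :
    (((2 * min n J + 2) * (K + 1) : ℕ) : ℝ) ≤
      6 * C₂ * (C₁ + 1) * ℓ ^ 2 * (n * u ^ 6) := by
  rw [min_eq_left hJn]
  push_cast
  have hn1 : (1 : ℝ) ≤ n := by exact_mod_cast hn
  have hnJ : (n : ℝ) ≤ C₁ * ℓ * u := le_trans (by exact_mod_cast hJn) hJ
  have h3 : (n : ℝ) * u ^ 2 ≤ C₁ * ℓ * u ^ 6 := by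
    calc (n : ℝ) * u ^ 2 ≤ C₁ * ℓ * u * u ^ 2 := by gcongr
      _ = C₁ * ℓ * u ^ 3 := by ring
      _ ≤ C₁ * ℓ * u ^ 6 := by gcongr; norm_num
  have h4 : (n : ℝ) * u ^ 2 + u ^ 6 ≤ (C₁ + 1) * ℓ * u ^ 6 := by
    have : 1 * u ^ 6 ≤ ℓ * u ^ 6 := by gcongr
    linarith
  have h5 : 2 * (n : ℝ) + 2 ≤ 6 * n := by linarith
  calc (2 * (n : ℝ) + 2) * (K + 1)
      ≤ 6 * n * (C₂ * ℓ * ((C₁ + 1) * ℓ * u ^ 6)) := by gcongr; exact hK.trans (by gcongr)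
    _ = _ := by ring

end LogBarrier

end

/-! ### Assembly of the complexity bound -/

theorem corollary4p8 (P : LogBarrier.Params) (LH Ug UH Δ a b : ℝ)
    (hLH : 0 < LH) (hUg : 0 < Ug) (hUH : 0 < UH) (ha : 0 < a) :
    -- the constants of the order estimates: independent of the dimension and the tolerance
    ∃ (C : ℝ) (q : ℕ), ∀ (n : ℕ) (A : LogBarrier.Input P n) (flow : ℝ),
      0 < n → A.SmoothOnPath LH → A.BoundedBelow flow → A.BoundedDerivs Ug UH →
      A.MBounded (UH + A.μ) →
      ∃ (k : ℕ) (x : E n), k ≤ A.K1 LH flow + 1 ∧ A.iterate k = some x ∧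
        LogBarrier.FirstOrder A.f A.εg x ∧
        -- `R` is a common bound for the initial residuals of the conjugate gradient calls
        ∀ R : ℝ, (∀ l < k, ∀ z, A.iterate l = some z → ‖A.g z‖ ≤ R) →
          R ≤ Ug + A.μ * √n →
          let J : ℕ := LogBarrier.CG.capJ (UH + A.μ) A.εH P.ζr A.cμ R
          let bound : ℕ := (2 * min n J + 2) * (A.K1 LH flow + 1)
          A.work k ≤ bound ∧
          (A.f A.x0 - flow ≤ Δ → (∀ i, a ≤ A.x0 i ∧ A.x0 i ≤ b) →
            (J < n → (bound : ℝ) ≤ C * (1 + Real.log (n / A.εg)) ^ q *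
              (A.εg ^ (-(7 / 4) : ℝ) + n * A.εg ^ (-(3 / 4) : ℝ))) ∧
            (n ≤ J → (bound : ℝ) ≤ C * (1 + Real.log (n / A.εg)) ^ q *
              (n * A.εg ^ (-(3 / 2) : ℝ)))) := by
  obtain ⟨C₁, hC₁, hJ⟩ := LogBarrier.exists_capJ_bound P hUg hUH
  obtain ⟨C₂, hC₂, hK⟩ := LogBarrier.exists_K1_bound P hLH Δ a b ha
  refine ⟨6 * C₂ * (C₁ + 1), 2, fun n A flow hn hA hflow _ hM => ?_⟩
  classical
  have hex := A.exists_firstOrder hn hLH hA hflow hM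
  -- The first first-order iterate is taken, so that every iteration before it calls capped
  -- conjugate gradients and its cost is under control.
  have hex' : ∃ k, ∃ x, A.iterate k = some x ∧ LogBarrier.FirstOrder A.f A.εg x := by
    obtain ⟨k, -, x, hx⟩ := hex
    exact ⟨k, x, hx⟩
  have hle : Nat.find hex' ≤ A.K1 LH flow + 1 := by
    obtain ⟨k, hk, x, hx⟩ := hex
    exact (Nat.find_min' hex' ⟨x, hx⟩).trans hk
  obtain ⟨x, hx, hfo⟩ := Nat.find_spec hex'
  have hbefore : ∀ l < Nat.find hex', ∀ z, A.iterate l = some z →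
      ¬ LogBarrier.FirstOrder A.f A.εg z :=
    fun l hl z hz hz' => Nat.find_min hex' hl ⟨z, hz, hz'⟩
  refine ⟨Nat.find hex', x, hle, hx, hfo, fun R hR hRle => ⟨?_, fun hΔ hab => ?_⟩⟩
  · exact A.work_le hLH hA hM hle hbefore hR
  · obtain ⟨hε0, hε1⟩ := A.εg_mem
    obtain ⟨-, hℓ⟩ := LogBarrier.one_le_one_add_log hn hε0 hε1
    have hu := LogBarrier.one_le_rpow_neg_quarter hε0 hε1
    have hJ := hJ n A R hn hRle
    have hK := hK n A flow hn hΔ hab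
    have hpow := LogBarrier.rpow_eq_quarter_pow hε0
    refine ⟨fun hJn => ?_, fun hnJ => ?_⟩
    · have := LogBarrier.order_few hℓ hu hC₁ hJ hK hJn
      rw [hpow 7, hpow 3] at this
      exact_mod_cast this
    · have := LogBarrier.order_many hℓ hu hC₁ hC₂ hJ hK hn hnJ
      rw [hpow 6] at this
      norm_num at this ⊢
      exact this
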